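/- Let $\mathbb M_2$ be the Minkowski plane with pseudo-Cartesian coordinates $(t,x)$ and metric $g=\mathrm{diag}(1,-1)$. A Killing 2-tensor is a smooth symmetric tensor field $K$ with $\nabla_{(i}K_{jk)}=0$. Every Killing 2-tensor has, for a unique $(A,B,C,\alpha,\beta,\gamma)\in\mathbb R^6$, the contravariant components $$K^{tt}=A+2\alpha x+\gamma x^2,\qquad K^{tx}=K^{xt}=C+\alpha t+\beta x+\gamma tx,\qquad K^{xx}=B+2\beta t+\gamma t^2,$$ and all such tensors are Killing. Let $G$ be the group of transformations of the space of Killing 2-tensors generated by those induced (by push-forward) by the isometries and by the dilatations $q\mapsto sq$, $s>0$, of $\mathbb M_2$, by $K\mapsto K+\tau g$ ($\tau\in\mathbb R$) and by $K\mapsto\lambda K$ ($\lambda\neq0$). In particular it contains $R_0:K\mapsto-K$ and the maps $R_1:(C,\alpha)\mapsto(-C,-\alpha)$, $R_2:(C,\beta)\mapsto(-C,-\beta)$ induced by the reflections $x\mapsto-x$, $t\mapsto-t$. Put $$Z_+=\gamma(A+B-2C)-(\alpha-\beta)^2,\qquad Z_-=\gamma(A+B+2C)-(\alpha+\beta)^2,$$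 $$S_1:\ \gamma=0;\qquad S_2:\ Z_+Z_-=0;\qquad S_3:\ \gamma(A+B)=\alpha^2+\beta^2,\ \gamma C=\alpha\beta;$$ $$S_4:\ (\gamma=0,\ \alpha=\beta,\ A+B=2C)\ \text{or}\ (\gamma=0,\ \alpha=-\beta,\ A+B=-2C);$$ $$S_5:\ \alpha=\beta=\gamma=C=0,\ B=-A.$$ Then $G$ has exactly 14 orbits on the space of Killing 2-tensors, namely the following sets (with the traditional names of the webs; tensors are listed by parameters $(A,B,C,\alpha,\beta,\gamma)$): - M1 (SC9): outside $S_1\cup S_2$, $Z_+>0$ and $Z_->0$; contains $(0,1,0,0,0,1)$. - M2 (SC8): outside $S_1\cup S_2$, $Z_+$ and $Z_-$ of different sign; contains $(0,0,1,0,0,1)$. - M3 (SC5 and SC10): outside $S_1\cup S_2$, $Z_+<0$ and $Z_-<0$; contains $(0,-1,0,0,0,1)$. - M4 (SC6): in $S_2\setminus(S_1\cup S_3)$, the non-vanishing one of $Z_\pm$ is positive; contains $(1,1,\pm1,0,0,1)$. - M5 (SC7): in $S_2\setminus(S_1\cup S_3)$, the non-vanishing one of $Z_\pm$ is negative; contains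 $(-1,-1,\pm1,0,0,1)$. - M6 (SC2): $S_3\setminus S_1$; contains $(0,0,0,0,0,1)$. - M7 (SC4, first web): the part of $S_1\setminus S_2$ containing the $\alpha$ axis, i.e. with $\alpha^2>\beta^2$; contains $(0,0,0,1,0,0)$. - M8 (SC4, second web): the part of $S_1\setminus S_2$ containing the $\beta$ axis, i.e. with $\alpha^2<\beta^2$; contains $(0,0,0,0,1,0)$. - M9 (SC3): $(S_1\cap S_2)\setminus(S_3\cup S_4)$; contains $(1,1,0,1,1,0)$ and $(1,1,-1,1,1,0)$. - M10: $S_4\setminus S_3$; contains $(0,0,0,1,1,0)$. - M11 (SC1): the part of $(S_1\cap S_3)\setminus S_4$ containing the plane $C=0$, i.e. with $(2C)^2<(A+B)^2$; contains $(1,0,0,0,0,0)$. - M12: the part of $(S_1\cap S_3)\setminus S_4$ with $(2C)^2>(A+B)^2$; contains $(0,0,1,0,0,0)$. - M13: $(S_3\cap S_4)\setminus S_5$; contains $(1,1,1,0,0,0)$. - M14: $S_5$, the set of the multiples $\tau g$ of the metric (such as $g$, that is $(1,-1,0,0,0,0)$). Call a Killing 2-tensor characteristic if its eigenvalues (those of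 $K^i{}_j$) are real and simple on some non-empty open set; its web is then given by its two orthogonal families of eigendirections on the set of points where the eigenvalues are real and simple. The ten orbits M1–M9 and M11 consist of characteristic tensors, and the four orbits M10, M12, M13, M14 consist of non-characteristic tensors. Moreover, two characteristic Killing tensors lie in the same orbit if and only if their webs are of the same type, that is, an isometry followed by a dilatation of $\mathbb M_2$ maps one web onto the other; so there are exactly ten types of webs. -/

import Mathlib

open scoped ContDiff

namespace Minkowski

/-- The Minkowski plane in pseudo-Cartesian coordinates: `q 0 = t`, `q 1 = x`. -/
abbrev Plane : Type := Fin 2 → ℝ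

/-- The metric `diag (1, -1)`; its covariant and contravariant components coincide. -/
def metric : Matrix (Fin 2) (Fin 2) ℝ := !![1, 0; 0, -1]

/-- A field of contravariant 2-tensors, given by its components `K^{ij}`. -/
abbrev TensorField : Type := Plane → Matrix (Fin 2) (Fin 2) ℝ

/-- The covariant components `K_{ij} = g_{ik} K^{kl} g_{lj}`. -/
def lower (K : TensorField) : TensorField := fun q => metric * K q * metric

/-- The mixed components `K^i_j = K^{ik} g_{kj}`; eigenvalues and eigenvectors of a 2-tensor are
those of this endomorphism. -/
noncomputable def mixed (K : TensorField) (q : Plane) : Module.End ℝ Plane :=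
  Matrix.toLin' (K q * metric)

/-- The partial derivative of a function with respect to the `i`-th coordinate. -/
noncomputable def partialDeriv (i : Fin 2) (f : Plane → ℝ) (q : Plane) : ℝ :=
  fderiv ℝ f q (Pi.single i 1)

/-- Killing 2-tensors: smooth symmetric tensor fields with `∇_(i K_jk) = 0`. In pseudo-Cartesian
coordinates the Christoffel symbols vanish and the covariant derivative is the partial one. -/
structure IsKilling (K : TensorField) : Prop where
  smooth : ∀ i j, ContDiff ℝ ∞ (fun q => K q i j)
  symm : ∀ q, (K q).IsSymm
  killing : ∀ q i j k,
    partialDeriv i (fun q => lower K q j k) q + partialDeriv j (fun q => lower K q k i) q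
      + partialDeriv k (fun q => lower K q i j) q = 0

/-- The space of all Killing 2-tensors on the Minkowski plane. -/
abbrev KillingTensor : Type := {K : TensorField // IsKilling K}

/-! ### The group acting on Killing tensors -/

/-- The Jacobian matrix of a map of the plane. -/
noncomputable def jacobian (Φ : Plane → Plane) (q : Plane) : Matrix (Fin 2) (Fin 2) ℝ :=
  LinearMap.toMatrix' (fderiv ℝ Φ q : Plane →ₗ[ℝ] Plane)

/-- The transformation of contravariant 2-tensor fields induced by a map of the plane:
`K̂^{ij}(q) = J^i_k(Φ⁻¹ q) J^j_l(Φ⁻¹ q) K^{kl}(Φ⁻¹ q)`. -/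
noncomputable def pushforward (Φ : Plane ≃ Plane) (K : TensorField) : TensorField := fun q =>
  jacobian Φ (Φ.symm q) * K (Φ.symm q) * (jacobian Φ (Φ.symm q)).transpose

/-- Isometries of the Minkowski plane: diffeomorphisms that preserve the metric. These comprise
the translations, the boosts and the two reflections `(t, x) ↦ (t, -x)`, `(t, x) ↦ (-t, x)`. -/
structure IsIsometry (Φ : Plane ≃ Plane) : Prop where
  smooth : ContDiff ℝ ∞ Φ
  smooth_symm : ContDiff ℝ ∞ Φ.symm
  metric_eq : ∀ q, (jacobian Φ q).transpose * metric * jacobian Φ q = metric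

/-- Dilatations of the Minkowski plane. -/
def IsDilatation (Φ : Plane ≃ Plane) : Prop := ∃ s : ℝ, 0 < s ∧ ∀ q, Φ q = s • q

/-- The generators: transformations induced by isometries and by dilatations, addition of a
multiple of the metric, and multiplication by a non-zero constant. The three discrete
transformations are among them: `R₀ : K ↦ -K` is multiplication by `-1`, while
`R₁ : (C, α) ↦ (-C, -α)` and `R₂ : (C, β) ↦ (-C, -β)` are induced by the isometries
`(t, x) ↦ (t, -x)` and `(t, x) ↦ (-t, x)`. -/
inductive IsGenerator (σ : Equiv.Perm KillingTensor) : Prop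
  | isometry (Φ : Plane ≃ Plane) (hΦ : IsIsometry Φ)
      (h : ∀ K, (σ K : TensorField) = pushforward Φ K)
  | dilatation (Φ : Plane ≃ Plane) (hΦ : IsDilatation Φ)
      (h : ∀ K, (σ K : TensorField) = pushforward Φ K)
  | addMetric (τ : ℝ) (h : ∀ K, (σ K : TensorField) = fun q => K.1 q + τ • metric)
  | scale (c : ℝ) (hc : c ≠ 0) (h : ∀ K, (σ K : TensorField) = fun q => c • K.1 q)

/-- The group of transformations of the space of Killing tensors under consideration. -/
def webGroup : Subgroup (Equiv.Perm KillingTensor) :=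
  Subgroup.closure {σ | IsGenerator σ}

/-! ### Characteristic tensors and their webs -/

/-- At `q` the eigenvalues of `K` are real and simple. -/
def IsRegularAt (K : TensorField) (q : Plane) : Prop :=
  ∃ a b : ℝ, a ≠ b ∧ (mixed K q).HasEigenvalue a ∧ (mixed K q).HasEigenvalue b

/-- Characteristic Killing tensors: the eigenvalues are real and simple on some non-empty open
region, where the tensor then defines a web (outside of it lie singular points). Normality of the
eigenvectors is automatic: in dimension two the distribution orthogonal to an eigenvector has
rank one, so it is integrable. -/
def IsCharacteristic (K : TensorField) : Prop :=
  ∃ U : Set Plane, IsOpen U ∧ U.Nonempty ∧ ∀ q ∈ U, IsRegularAt K q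

/-- The web of a tensor: its two orthogonal families of eigendirections on the set of regular
points. The leaves of the two foliations are the curves tangent to them. -/
def web (K : TensorField) : Set (Plane × Plane) :=
  {w | IsRegularAt K w.1 ∧ ∃ μ : ℝ, (mixed K w.1).HasEigenvector μ w.2}

/-- The action of a map of the plane on (points with) directions. -/
noncomputable def mapDirections (Φ : Plane ≃ Plane) (W : Set (Plane × Plane)) :
    Set (Plane × Plane) :=
  (fun w => (Φ w.1, fderiv ℝ Φ w.1 w.2)) '' W

/-- Two tensors define webs of the same type when an isometry followed by a dilatation carries
the web of the first onto the web of the second. -/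
def SameWebType (K L : TensorField) : Prop :=
  ∃ Φ Ψ : Plane ≃ Plane, IsIsometry Φ ∧ IsDilatation Ψ ∧
    mapDirections Ψ (mapDirections Φ (web K)) = web L

/-! ### Parameters and the fourteen classes -/

/-- The six parameters of a Killing tensor. -/
@[ext]
structure Param where
  A : ℝ
  B : ℝ
  C : ℝ
  α : ℝ
  β : ℝ
  γ : ℝ

namespace Param

/-- The tensor field with given parameters. -/
def field (p : Param) : TensorField := fun q =>
  !![p.A + 2 * p.α * q 1 + p.γ * q 1 ^ 2, p.C + p.α * q 0 + p.β * q 1 + p.γ * q 0 * q 1;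
     p.C + p.α * q 0 + p.β * q 1 + p.γ * q 0 * q 1, p.B + 2 * p.β * q 0 + p.γ * q 0 ^ 2]

/-- `Z₊ = γ (A + B - 2C) - (α - β)²`. -/
def Zpos (p : Param) : ℝ := p.γ * (p.A + p.B - 2 * p.C) - (p.α - p.β) ^ 2

/-- `Z₋ = γ (A + B + 2C) - (α + β)²`. -/
def Zneg (p : Param) : ℝ := p.γ * (p.A + p.B + 2 * p.C) - (p.α + p.β) ^ 2

def S₁ : Set Param := {p | p.γ = 0}

def S₂ : Set Param := {p | p.Zpos * p.Zneg = 0}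

def S₃ : Set Param := {p | p.γ * (p.A + p.B) = p.α ^ 2 + p.β ^ 2 ∧ p.γ * p.C = p.α * p.β}

def S₄ : Set Param :=
  {p | p.γ = 0 ∧ p.α = p.β ∧ p.A + p.B = 2 * p.C} ∪
  {p | p.γ = 0 ∧ p.α = -p.β ∧ p.A + p.B = -2 * p.C}

def S₅ : Set Param := {p | p.α = 0 ∧ p.β = 0 ∧ p.γ = 0 ∧ p.B = -p.A ∧ p.C = 0}

end Param

/-- The names of the fourteen classes, with the usual labels of the separable webs. -/
inductive OrbitName : Type
  /-- SC9, elliptic coordinates of type I -/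
  | M1
  /-- SC8, hyperbolic coordinates of type I -/
  | M2
  /-- SC5 and SC10, elliptic coordinates of type II -/
  | M3
  /-- SC6, hyperbolic coordinates of type II -/
  | M4
  /-- SC7, hyperbolic coordinates of type III -/
  | M5
  /-- SC2, polar coordinates -/
  | M6
  /-- SC4, parabolic coordinates of type I, first web -/
  | M7
  /-- SC4, parabolic coordinates of type I, second web -/
  | M8
  /-- SC3, parabolic coordinates of type II -/
  | M9
  /-- no characteristic tensors -/
  | M10
  /-- SC1, Cartesian coordinates -/
  | M11
  /-- no characteristic tensors -/
  | M12
  /-- no characteristic tensors -/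
  | M13
  /-- multiples of the metric, no characteristic tensors -/
  | M14

namespace OrbitName

open Param

/-- The parameters of the tensors of each class. The part of `S₁ \ S₂` that contains the `α` axis
is `β² < α²`; the part of `(S₁ ∩ S₃) \ S₄` that contains the plane `C = 0` is
`(2C)² < (A + B)²`. -/
def params : OrbitName → Set Param
  | M1 => (S₁ ∪ S₂)ᶜ ∩ {p | 0 < p.Zpos ∧ 0 < p.Zneg}
  | M2 => (S₁ ∪ S₂)ᶜ ∩ {p | (0 < p.Zpos ∧ p.Zneg < 0) ∨ (p.Zpos < 0 ∧ 0 < p.Zneg)}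
  | M3 => (S₁ ∪ S₂)ᶜ ∩ {p | p.Zpos < 0 ∧ p.Zneg < 0}
  | M4 => (S₂ \ (S₁ ∪ S₃)) ∩ {p | 0 < p.Zpos ∨ 0 < p.Zneg}
  | M5 => (S₂ \ (S₁ ∪ S₃)) ∩ {p | p.Zpos < 0 ∨ p.Zneg < 0}
  | M6 => S₃ \ S₁
  | M7 => (S₁ \ S₂) ∩ {p | p.β ^ 2 < p.α ^ 2}
  | M8 => (S₁ \ S₂) ∩ {p | p.α ^ 2 < p.β ^ 2}
  | M9 => (S₁ ∩ S₂) \ (S₃ ∪ S₄)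
  | M10 => S₄ \ S₃
  | M11 => ((S₁ ∩ S₃) \ S₄) ∩ {p | (2 * p.C) ^ 2 < (p.A + p.B) ^ 2}
  | M12 => ((S₁ ∩ S₃) \ S₄) ∩ {p | (p.A + p.B) ^ 2 < (2 * p.C) ^ 2}
  | M13 => (S₃ ∩ S₄) \ S₅
  | M14 => S₅

/-- The Killing tensors of each class. -/
def tensors (m : OrbitName) : Set KillingTensor :=
  {K | ∃ p ∈ m.params, (K : TensorField) = p.field}

/-- Parameters of representatives of each class. -/
def representatives : OrbitName → Set Param
  | M1 => {⟨0, 1, 0, 0, 0, 1⟩}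
  | M2 => {⟨0, 0, 1, 0, 0, 1⟩}
  | M3 => {⟨0, -1, 0, 0, 0, 1⟩}
  | M4 => {⟨1, 1, 1, 0, 0, 1⟩, ⟨1, 1, -1, 0, 0, 1⟩}
  | M5 => {⟨-1, -1, -1, 0, 0, 1⟩, ⟨-1, -1, 1, 0, 0, 1⟩}
  | M6 => {⟨0, 0, 0, 0, 0, 1⟩}
  | M7 => {⟨0, 0, 0, 1, 0, 0⟩}
  | M8 => {⟨0, 0, 0, 0, 1, 0⟩}
  | M9 => {⟨1, 1, 0, 1, 1, 0⟩, ⟨1, 1, -1, 1, 1, 0⟩}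
  | M10 => {⟨0, 0, 0, 1, 1, 0⟩}
  | M11 => {⟨1, 0, 0, 0, 0, 0⟩}
  | M12 => {⟨0, 0, 1, 0, 0, 0⟩}
  | M13 => {⟨1, 1, 1, 0, 0, 0⟩}
  | M14 => {⟨1, -1, 0, 0, 0, 0⟩}

end OrbitName

end Minkowski

namespace Minkowski

/-! ### The general Killing tensor -/

/-! In the null coordinates `u = t + x`, `v = t - x` the Killing equation says that `K^{uu} = P(u)`
and `K^{vv} = Q(v)` are polynomials of degree at most two with a common leading coefficient `γ`: `P
= γ u² + 2 a u + c` and `Q = γ v² + 2 b v + d`. The remaining component `K^{uv}` is determined by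
`P` and `Q` up to an additive constant `e`, and adding a multiple of the metric changes exactly that
constant. Modulo the metric, a Killing tensor is therefore the pair `(P, Q)`.

An isometry is affine, and together with the dilatations the isometries generate the maps `(u, v) ↦
(k u + u₀, l v + v₀)` with `k l > 0` and those composed with the exchange of `u` and `v`. The
problem is thus to classify pairs `(P, Q)` up to independent affine substitutions with `k l > 0`,
exchange, and a common non-zero factor. The quantities `γ c - a²` and `γ d - b²` (that is, `Zneg`
and `Zpos`) are minus the quarter discriminants, and they are only multiplied by positive numbers.
If `γ ≠ 0`, completing squares shows that their signs decide everything. If `γ = 0`, one looks at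
the sign of `a b`, at the constant `d` or `c` when one slope vanishes, and at the sign of `c d` when
both do. Invariance of these conditions (`nullClass_direct`, `nullClass_scale`, `nullClass_swap`)
keeps the classes apart; reduction to a normal form (`orbit_eq_normalForm`) shows that each is one
orbit.

The eigenvalues `μ` solve `(2 μ - K^{uv})² = P Q`, so regular points are those with `P Q > 0`, and
eigenvectors there satisfy `P w_v² = Q w_u²`. This settles which classes are characteristic. It also
shows that the web records the ratio `P : Q` on an open set. Since `P` depends on `u` alone and `Q`
on `v` alone, separation of variables recovers the pair up to a common factor
(`orbit_eq_of_web_eq`), hence the orbit. -/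

lemma hasDerivAt_fst {F : Plane → ℝ} (hF : Differentiable ℝ F) (t x : ℝ) :
    HasDerivAt (fun s => F ![s, x]) (partialDeriv 0 F ![t, x]) t := by
  have hline : HasDerivAt (fun s : ℝ => (![s, x] : Plane)) (Pi.single 0 1) t := by
    rw [hasDerivAt_pi]
    intro i
    fin_cases i
    · simpa using hasDerivAt_id' t
    · simpa using hasDerivAt_const t x
  exact (hF ![t, x]).hasFDerivAt.comp_hasDerivAt t hline

lemma hasDerivAt_snd {F : Plane → ℝ} (hF : Differentiable ℝ F) (t x : ℝ) :
    HasDerivAt (fun s => F ![t, s]) (partialDeriv 1 F ![t, x]) x := by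
  have hline : HasDerivAt (fun s : ℝ => (![t, s] : Plane)) (Pi.single 1 1) x := by
    rw [hasDerivAt_pi]
    intro i
    fin_cases i
    · simpa using hasDerivAt_const x t
    · simpa using hasDerivAt_id' x
  exact (hF ![t, x]).hasFDerivAt.comp_hasDerivAt x hline

lemma hasDerivAt_quadratic (a b c s : ℝ) :
    HasDerivAt (fun s => a + b * s + c * s ^ 2) (b + 2 * c * s) s := by
  refine ((((hasDerivAt_id' s).const_mul b).const_add a).fun_add
    (((hasDerivAt_id' s).fun_pow 2).const_mul c)).congr_deriv ?_
  push_cast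
  ring

/-- A function with affine derivative is quadratic. -/
lemma eq_quadratic_of_hasDerivAt {g : ℝ → ℝ} {b c : ℝ}
    (h : ∀ s, HasDerivAt g (b + 2 * c * s) s) (s : ℝ) : g s = g 0 + b * s + c * s ^ 2 := by
  have hd : ∀ s, HasDerivAt (fun s => g s - (0 + b * s + c * s ^ 2)) 0 s := by
    intro s
    exact ((h s).fun_sub (hasDerivAt_quadratic 0 b c s)).congr_deriv (sub_self _)
  have := is_const_of_deriv_eq_zero (fun s => (hd s).differentiableAt)
    (fun s => (hd s).deriv) s 0
  simp at this
  linarith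

lemma plane_eta (q : Plane) : ![q 0, q 1] = q := by
  ext i; fin_cases i <;> rfl

lemma lower_apply (K : TensorField) (q : Plane) :
    lower K q = !![K q 0 0, -K q 0 1; -K q 1 0, K q 1 1] := by
  ext i j
  fin_cases i <;> fin_cases j <;>
    simp [lower, metric, Matrix.mul_apply, Matrix.vecMul, dotProduct, Fin.sum_univ_two]

lemma partialDeriv_neg (i : Fin 2) (f : Plane → ℝ) (q : Plane) :
    partialDeriv i (fun q => -f q) q = -partialDeriv i f q := by
  simp [partialDeriv]

/-- The Killing equations make `K^{tt}` a function of `x` and `K^{xx}` a function of `t`, and give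
both partial derivatives of `K^{tx}` as half of their derivatives. So `K^{tx}` is affine in each
variable separately, and comparing the two expressions forces those derivatives to be affine with
the same slope `2 γ`. -/
lemma IsKilling.exists_param {K : TensorField} (hK : IsKilling K) :
    ∃ p : Param, K = p.field := by
  have hd : ∀ i j, Differentiable ℝ (fun q => K q i j) := fun i j =>
    (hK.smooth i j).differentiable (by simp)
  have hsym : ∀ q, K q 1 0 = K q 0 1 := fun q => (hK.symm q).apply 0 1
  have e1 : ∀ q, partialDeriv 0 (fun q => K q 0 0) q = 0 := by
    intro q
    have := hK.killing q 0 0 0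
    simp only [lower_apply, Matrix.of_apply, Matrix.cons_val_zero, Matrix.cons_val',
      Matrix.cons_val_fin_one] at this
    linarith
  have e2 : ∀ q, partialDeriv 1 (fun q => K q 1 1) q = 0 := by
    intro q
    have := hK.killing q 1 1 1
    simp only [lower_apply, Matrix.of_apply, Matrix.cons_val',
      Matrix.cons_val_one, Matrix.cons_val_fin_one] at this
    linarith
  have e3 : ∀ q, partialDeriv 0 (fun q => K q 0 1) q
      = partialDeriv 1 (fun q => K q 0 0) q / 2 := by
    intro q
    have := hK.killing q 0 0 1
    simp only [lower_apply, Matrix.of_apply, Matrix.cons_val_zero, Matrix.cons_val',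
      Matrix.cons_val_one, Matrix.cons_val_fin_one, hsym, partialDeriv_neg] at this
    linarith
  have e4 : ∀ q, partialDeriv 1 (fun q => K q 0 1) q
      = partialDeriv 0 (fun q => K q 1 1) q / 2 := by
    intro q
    have := hK.killing q 1 1 0
    simp only [lower_apply, Matrix.of_apply, Matrix.cons_val_zero, Matrix.cons_val',
      Matrix.cons_val_one, Matrix.cons_val_fin_one, hsym, partialDeriv_neg] at this
    linarith
  have hf : ∀ t x, K ![t, x] 0 0 = K ![0, x] 0 0 := by
    intro t x
    have := eq_quadratic_of_hasDerivAt (g := fun s => K ![s, x] 0 0) (b := 0) (c := 0)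
      (fun s => by simpa [e1] using hasDerivAt_fst (hd 0 0) s x) t
    simpa using this
  have hh : ∀ t x, K ![t, x] 1 1 = K ![t, 0] 1 1 := by
    intro t x
    have := eq_quadratic_of_hasDerivAt (g := fun s => K ![t, s] 1 1) (b := 0) (c := 0)
      (fun s => by simpa [e2] using hasDerivAt_snd (hd 1 1) t s) x
    simpa using this
  set f' : ℝ → ℝ := fun x => partialDeriv 1 (fun q => K q 0 0) ![0, x] with hf'
  set h' : ℝ → ℝ := fun t => partialDeriv 0 (fun q => K q 1 1) ![t, 0] with hh'
  have df : ∀ t x, partialDeriv 1 (fun q => K q 0 0) ![t, x] = f' x := by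
    intro t x
    refine (hasDerivAt_snd (hd 0 0) t x).unique ?_
    simp only [hf t]
    exact hasDerivAt_snd (hd 0 0) 0 x
  have dh : ∀ t x, partialDeriv 0 (fun q => K q 1 1) ![t, x] = h' t := by
    intro t x
    refine (hasDerivAt_fst (hd 1 1) t x).unique ?_
    simp only [hh _ x]
    exact hasDerivAt_fst (hd 1 1) t 0
  have m1 : ∀ t x, K ![t, x] 0 1 = K ![0, x] 0 1 + f' x / 2 * t := by
    intro t x
    have := eq_quadratic_of_hasDerivAt (g := fun s => K ![s, x] 0 1) (b := f' x / 2) (c := 0)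
      (fun s => by simpa [e3, df] using hasDerivAt_fst (hd 0 1) s x) t
    simpa using this
  have m2 : ∀ t x, K ![t, x] 0 1 = K ![t, 0] 0 1 + h' t / 2 * x := by
    intro t x
    have := eq_quadratic_of_hasDerivAt (g := fun s => K ![t, s] 0 1) (b := h' t / 2) (c := 0)
      (fun s => by simpa [e4, dh] using hasDerivAt_snd (hd 0 1) t s) x
    simpa using this
  -- The two formulas for `K^{tx}` are expanded down to the value at the origin and equated.
  have key : ∀ t x, h' 0 * x + f' x * t = f' 0 * t + h' t * x := by
    intro t x
    have := m1 t x
    rw [m2 t x, m1 t 0, m2 0 x] at this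
    linarith
  set γ : ℝ := (h' 1 - h' 0) / 2 with hγ
  have f'eq : ∀ x, f' x = f' 0 + 2 * γ * x := fun x => by
    have := key 1 x
    rw [hγ]; linarith
  have h'eq : ∀ t, h' t = h' 0 + 2 * γ * t := fun t => by
    have h1 := key t 1
    have h2 := key 1 1
    have : f' 1 = f' 0 + 2 * γ := by rw [hγ]; linarith
    rw [this] at h1
    linarith
  have fq : ∀ x, K ![0, x] 0 0 = K ![0, 0] 0 0 + f' 0 * x + γ * x ^ 2 := fun x =>
    eq_quadratic_of_hasDerivAt (g := fun s => K ![0, s] 0 0)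
      (fun s => by simpa [← f'eq] using hasDerivAt_snd (hd 0 0) 0 s) x
  have hq : ∀ t, K ![t, 0] 1 1 = K ![0, 0] 1 1 + h' 0 * t + γ * t ^ 2 := fun t =>
    eq_quadratic_of_hasDerivAt (g := fun s => K ![s, 0] 1 1)
      (fun s => by simpa [← h'eq] using hasDerivAt_fst (hd 1 1) s 0) t
  refine ⟨⟨K ![0, 0] 0 0, K ![0, 0] 1 1, K ![0, 0] 0 1, f' 0 / 2, h' 0 / 2, γ⟩, ?_⟩
  funext q
  have c00 : K q 0 0 = K ![0, 0] 0 0 + f' 0 * q 1 + γ * q 1 ^ 2 := by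
    rw [← fq, ← hf (q 0), plane_eta]
  have c11 : K q 1 1 = K ![0, 0] 1 1 + h' 0 * q 0 + γ * q 0 ^ 2 := by
    rw [← hq, ← hh _ (q 1), plane_eta]
  have c01 : K q 0 1 = K ![0, 0] 0 1 + h' 0 / 2 * q 1
      + (f' 0 + 2 * γ * q 1) / 2 * q 0 := by
    rw [← m2 0 (q 1), ← f'eq, ← m1, plane_eta]
  ext i j
  fin_cases i <;> fin_cases j <;> simp only [Param.field, Fin.zero_eta, Fin.mk_one,
    Matrix.of_apply, Matrix.cons_val_zero,
    Matrix.cons_val', Matrix.cons_val_one, Matrix.cons_val_fin_one, hsym, c00, c11, c01] <;> ring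

lemma partialDeriv_coord_poly (c₀ c₁ c₂ c₃ c₄ c₅ : ℝ) (q : Plane) (i : Fin 2) :
    partialDeriv i (fun q => c₀ + c₁ * q 0 + c₂ * q 1 + c₃ * q 0 ^ 2 + c₄ * q 0 * q 1
      + c₅ * q 1 ^ 2) q
      = if i = 0 then c₁ + 2 * c₃ * q 0 + c₄ * q 1 else c₂ + c₄ * q 0 + 2 * c₅ * q 1 := by
  have hd : Differentiable ℝ (fun q : Plane => c₀ + c₁ * q 0 + c₂ * q 1 + c₃ * q 0 ^ 2
      + c₄ * q 0 * q 1 + c₅ * q 1 ^ 2) := by fun_prop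
  have hq := plane_eta q
  fin_cases i
  · have h1 := hasDerivAt_fst hd (q 0) (q 1)
    rw [hq] at h1
    refine h1.unique ?_
    have h2 := hasDerivAt_quadratic (c₀ + c₂ * q 1 + c₅ * q 1 ^ 2) (c₁ + c₄ * q 1) c₃ (q 0)
    refine (h2.congr_of_eventuallyEq (.of_forall fun s => ?_)).congr_deriv ?_ <;> simp <;> ring
  · have h1 := hasDerivAt_snd hd (q 0) (q 1)
    rw [hq] at h1
    refine h1.unique ?_
    have h2 := hasDerivAt_quadratic (c₀ + c₁ * q 0 + c₃ * q 0 ^ 2) (c₂ + c₄ * q 0) c₅ (q 1)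
    refine (h2.congr_of_eventuallyEq (.of_forall fun s => ?_)).congr_deriv ?_ <;> simp <;> ring

lemma Param.isKilling_field (p : Param) : IsKilling p.field where
  smooth i j := by
    fin_cases i <;> fin_cases j <;> simp [Param.field] <;> fun_prop
  symm q := by
    ext i j
    fin_cases i <;> fin_cases j <;> simp [Param.field, Matrix.transpose_apply]
  killing q := by
    have h00 : (fun q => lower p.field q 0 0) = fun q : Plane => p.A + 0 * q 0 + (2 * p.α) * q 1
        + 0 * q 0 ^ 2 + 0 * q 0 * q 1 + p.γ * q 1 ^ 2 := by
      funext q; simp [lower_apply, Param.field]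
    have h01 : (fun q => lower p.field q 0 1) = fun q : Plane => -p.C + (-p.α) * q 0
        + (-p.β) * q 1 + 0 * q 0 ^ 2 + (-p.γ) * q 0 * q 1 + 0 * q 1 ^ 2 := by
      funext q; simp [lower_apply, Param.field]; ring
    have h10 : (fun q => lower p.field q 1 0) = fun q : Plane => -p.C + (-p.α) * q 0
        + (-p.β) * q 1 + 0 * q 0 ^ 2 + (-p.γ) * q 0 * q 1 + 0 * q 1 ^ 2 := by
      funext q; simp [lower_apply, Param.field]; ring
    have h11 : (fun q => lower p.field q 1 1) = fun q : Plane => p.B + (2 * p.β) * q 0 + 0 * q 1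
        + p.γ * q 0 ^ 2 + 0 * q 0 * q 1 + 0 * q 1 ^ 2 := by
      funext q; simp [lower_apply, Param.field]
    intro i j k
    fin_cases i <;> fin_cases j <;> fin_cases k <;>
      simp only [Fin.zero_eta, Fin.mk_one, h00, h01, h10, h11, partialDeriv_coord_poly] <;>
      simp <;> ring

lemma Param.field_injective : Function.Injective Param.field := by
  intro p p' h
  have c : ∀ t x i j, p.field ![t, x] i j = p'.field ![t, x] i j := fun t x i j => by rw [h]
  have a1 := c 0 0 0 0
  have a2 := c 0 0 0 1
  have a3 := c 0 0 1 1
  have a4 := c 0 1 0 0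
  have a5 := c 0 (-1) 0 0
  have a6 := c 1 0 1 1
  simp [Param.field] at a1 a2 a3 a4 a5 a6
  ext <;> linarith

lemma isKilling_iff (K : TensorField) : IsKilling K ↔ ∃! p : Param, K = p.field := by
  constructor
  · intro hK
    obtain ⟨p, rfl⟩ := hK.exists_param
    exact ⟨p, rfl, fun p' h => Param.field_injective h.symm⟩
  · rintro ⟨p, rfl, -⟩
    exact p.isKilling_field

/-! ### Isometries are affine -/

/-- The Minkowski inner product. -/
def inner2 (x y : Plane) : ℝ := x 0 * y 0 - x 1 * y 1

lemma inner2_mulVec {M : Matrix (Fin 2) (Fin 2) ℝ} (hM : M.transpose * metric * M = metric)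
    (x y : Plane) : inner2 (M.mulVec x) (M.mulVec y) = inner2 x y := by
  have e := fun i j => congrFun (congrFun hM i) j
  have e00 := e 0 0
  have e01 := e 0 1
  have e11 := e 1 1
  simp [Matrix.mul_apply, Fin.sum_univ_two, metric] at e00 e01 e11
  simp only [inner2, Matrix.mulVec, dotProduct, Fin.sum_univ_two]
  linear_combination x 0 * y 0 * e00 + x 1 * y 1 * e11 + (x 0 * y 1 + x 1 * y 0) * e01

lemma jacobian_mulVec (Φ : Plane → Plane) (q v : Plane) :
    (jacobian Φ q).mulVec v = fderiv ℝ Φ q v := by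
  rw [jacobian, LinearMap.toMatrix'_mulVec]; rfl

lemma eq_zero_of_inner2 {x : Plane} (h : ∀ y, inner2 x y = 0) : x = 0 := by
  ext i
  fin_cases i
  · simpa [inner2] using h ![1, 0]
  · simpa [inner2] using h ![0, 1]

/-- Differentiating `⟨DΦ x, DΦ y⟩ = ⟨x, y⟩` shows that `⟨D²Φ(z, x), DΦ y⟩` is skew in `x, y`; it is
also symmetric in `z, x`. A trilinear form with both properties vanishes, and `DΦ` is surjective, so
the nondegeneracy of the inner product kills `D²Φ`. This is the argument that gives uniqueness of
the Levi-Civita connection. -/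
lemma IsIsometry.fderiv_fderiv {Φ : Plane ≃ Plane} (hΦ : IsIsometry Φ) (q z x : Plane) :
    fderiv ℝ (fderiv ℝ Φ) q z x = 0 := by
  have hin : ∀ q x y, inner2 (fderiv ℝ Φ q x) (fderiv ℝ Φ q y) = inner2 x y := fun q x y => by
    simpa only [jacobian_mulVec] using inner2_mulVec (hΦ.metric_eq q) x y
  have hsmooth : ContDiff ℝ 1 (fderiv ℝ Φ) :=
    hΦ.smooth.fderiv_right (m := 1) (by norm_cast)
  have hD : HasFDerivAt (fderiv ℝ Φ) (fderiv ℝ (fderiv ℝ Φ) q) q :=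
    (hsmooth.differentiable (by simp) q).hasFDerivAt
  set D2 := fderiv ℝ (fderiv ℝ Φ) q with hD2
  have hsym : ∀ z x, D2 z x = D2 x z := fun z x =>
    second_derivative_symmetric (f := Φ) (f' := fderiv ℝ Φ)
      (fun y => ((hΦ.smooth.differentiable (by simp)) y).hasFDerivAt) hD z x
  have hc : ∀ x (i : Fin 2), HasFDerivAt (fun q => fderiv ℝ Φ q x i)
      ((ContinuousLinearMap.proj i).comp (D2.flip x)) q := by
    intro x i
    exact (ContinuousLinearMap.proj (R := ℝ) (φ := fun _ : Fin 2 => ℝ) i).hasFDerivAt.comp q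
      (hD.clm_apply (hasFDerivAt_const x q) |>.congr_fderiv (by ext; simp))
  have hskew : ∀ z x y, inner2 (D2 z x) (fderiv ℝ Φ q y)
      + inner2 (D2 z y) (fderiv ℝ Φ q x) = 0 := by
    intro z x y
    have h1 := ((hc x 0).mul (hc y 0)).sub ((hc x 1).mul (hc y 1))
    have h2 : HasFDerivAt (fun q => fderiv ℝ Φ q x 0 * fderiv ℝ Φ q y 0
        - fderiv ℝ Φ q x 1 * fderiv ℝ Φ q y 1) (0 : Plane →L[ℝ] ℝ) q := by
      have : (fun q => fderiv ℝ Φ q x 0 * fderiv ℝ Φ q y 0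
        - fderiv ℝ Φ q x 1 * fderiv ℝ Φ q y 1) = fun _ => inner2 x y := by
        funext q; exact hin q x y
      rw [this]; exact hasFDerivAt_const _ _
    have := DFunLike.congr_fun (h1.unique h2) z
    simp at this
    simp only [inner2]
    linarith
  have hT : ∀ z x y, inner2 (D2 z x) (fderiv ℝ Φ q y) = 0 := by
    intro z x y
    -- The three cyclic skewness relations, after the symmetry of `D2`, leave only the zero
    -- solution.
    have h1 := hskew z x y
    have h2 := hskew x y z
    have h3 := hskew y z x
    rw [hsym z y] at h1
    rw [hsym x z] at h2
    rw [hsym y x] at h3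
    linarith
  have hinj : Function.Injective (fderiv ℝ Φ q) := by
    rw [injective_iff_map_eq_zero]
    intro v hv
    refine eq_zero_of_inner2 fun y => ?_
    rw [← hin q, hv]; simp [inner2]
  have hsurj : Function.Surjective (fderiv ℝ Φ q) :=
    (LinearMap.injective_iff_surjective (f := (fderiv ℝ Φ q : Plane →ₗ[ℝ] Plane))).1 hinj
  refine eq_zero_of_inner2 fun y => ?_
  obtain ⟨y, rfl⟩ := hsurj y
  exact hT z x y

lemma IsIsometry.exists_affine {Φ : Plane ≃ Plane} (hΦ : IsIsometry Φ) :
    ∃ (M : Matrix (Fin 2) (Fin 2) ℝ) (w : Plane), M.transpose * metric * M = metric ∧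
      ∀ q, Φ q = M.mulVec q + w := by
  have hsmooth : ContDiff ℝ 1 (fderiv ℝ Φ) :=
    hΦ.smooth.fderiv_right (m := 1) (by norm_cast)
  have hconst : ∀ q, fderiv ℝ Φ q = fderiv ℝ Φ 0 := fun q =>
    is_const_of_fderiv_eq_zero (𝕜 := ℝ) (hsmooth.differentiable (by simp))
      (fun q => by ext z x : 2; simp [hΦ.fderiv_fderiv]) q 0
  refine ⟨jacobian Φ 0, Φ 0, hΦ.metric_eq 0, fun q => ?_⟩
  have hdiff : Differentiable ℝ (fun q => Φ q - fderiv ℝ Φ 0 q) :=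
    (hΦ.smooth.differentiable (by simp)).sub (fderiv ℝ Φ 0).differentiable
  have := is_const_of_fderiv_eq_zero (𝕜 := ℝ) hdiff (fun q => by
    rw [fderiv_fun_sub ((hΦ.smooth.differentiable (by simp)) q)
      (fderiv ℝ Φ 0).differentiableAt, ContinuousLinearMap.fderiv, hconst q, sub_self]) q 0
  simp only [map_zero, sub_zero] at this
  rw [jacobian_mulVec, ← this]
  abel

/-! ### Similarities in null coordinates -/

/-- The map acts on the null coordinates `u = t + x` and `v = t - x` by
`(u, v) ↦ (k u + a, l v + b)`. -/
structure IsDirect (Θ : Plane → Plane) (k l a b : ℝ) : Prop where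
  sum : ∀ q, Θ q 0 + Θ q 1 = k * (q 0 + q 1) + a
  diff : ∀ q, Θ q 0 - Θ q 1 = l * (q 0 - q 1) + b

/-- The map acts on the null coordinates `u = t + x` and `v = t - x` by
`(u, v) ↦ (k v + a, l u + b)`. -/
structure IsSwap (Θ : Plane → Plane) (k l a b : ℝ) : Prop where
  sum : ∀ q, Θ q 0 + Θ q 1 = k * (q 0 - q 1) + a
  diff : ∀ q, Θ q 0 - Θ q 1 = l * (q 0 + q 1) + b

/-- Similarities of the Minkowski plane. -/
def IsSimilarity (Θ : Plane → Plane) : Prop :=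
  ∃ k l a b : ℝ, 0 < k * l ∧ (IsDirect Θ k l a b ∨ IsSwap Θ k l a b)

lemma isDirect_iff {Θ : Plane → Plane} {k l a b : ℝ} : IsDirect Θ k l a b ↔ ∀ q, Θ q =
    (!![(k + l) / 2, (k - l) / 2; (k - l) / 2, (k + l) / 2]).mulVec q
      + ![(a + b) / 2, (a - b) / 2] := by
  constructor
  · intro h q
    have h1 := h.sum q
    have h2 := h.diff q
    ext i
    fin_cases i <;> simp [dotProduct, Fin.sum_univ_two] <;> linarith
  · intro h
    constructor <;> intro q <;> rw [h q] <;>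
      simp [dotProduct, Fin.sum_univ_two] <;> ring

lemma isSwap_iff {Θ : Plane → Plane} {k l a b : ℝ} : IsSwap Θ k l a b ↔ ∀ q, Θ q =
    (!![(k + l) / 2, (l - k) / 2; (k - l) / 2, -(k + l) / 2]).mulVec q
      + ![(a + b) / 2, (a - b) / 2] := by
  constructor
  · intro h q
    have h1 := h.sum q
    have h2 := h.diff q
    ext i
    fin_cases i <;> simp [dotProduct, Fin.sum_univ_two] <;> linarith
  · intro h
    constructor <;> intro q <;> rw [h q] <;>
      simp [dotProduct, Fin.sum_univ_two] <;> ring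

section Affine

variable {Θ : Plane → Plane} {M : Matrix (Fin 2) (Fin 2) ℝ} {w : Plane}

lemma hasFDerivAt_of_affine (h : ∀ q, Θ q = M.mulVec q + w) (q : Plane) :
    HasFDerivAt Θ (LinearMap.toContinuousLinearMap (Matrix.toLin' M)) q := by
  have : Θ = fun q => LinearMap.toContinuousLinearMap (Matrix.toLin' M) q + w := by
    funext q; simp [h q]
  rw [this]
  exact (ContinuousLinearMap.hasFDerivAt _).add_const w

lemma contDiff_of_affine (h : ∀ q, Θ q = M.mulVec q + w) : ContDiff ℝ ∞ Θ := by
  have : Θ = fun q => LinearMap.toContinuousLinearMap (Matrix.toLin' M) q + w := by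
    funext q; simp [h q]
  rw [this]
  exact (ContinuousLinearMap.contDiff _).add contDiff_const

lemma jacobian_of_affine (h : ∀ q, Θ q = M.mulVec q + w) (q : Plane) : jacobian Θ q = M := by
  rw [jacobian, (hasFDerivAt_of_affine h q).fderiv]
  simp

end Affine

lemma IsSimilarity.contDiff {Θ : Plane → Plane} (h : IsSimilarity Θ) : ContDiff ℝ ∞ Θ := by
  obtain ⟨k, l, a, b, -, h | h⟩ := h
  · exact contDiff_of_affine (isDirect_iff.1 h)
  · exact contDiff_of_affine (isSwap_iff.1 h)

lemma IsSimilarity.differentiable {Θ : Plane → Plane} (h : IsSimilarity Θ) :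
    Differentiable ℝ Θ := h.contDiff.differentiable (by simp)

lemma IsDirect.fderiv_apply {Θ : Plane → Plane} {k l a b : ℝ} (h : IsDirect Θ k l a b)
    (q v : Plane) : fderiv ℝ Θ q v 0 + fderiv ℝ Θ q v 1 = k * (v 0 + v 1) ∧
      fderiv ℝ Θ q v 0 - fderiv ℝ Θ q v 1 = l * (v 0 - v 1) := by
  rw [(hasFDerivAt_of_affine (isDirect_iff.1 h) q).fderiv]
  constructor <;> simp [Matrix.mulVec, dotProduct, Fin.sum_univ_two] <;> ring

lemma IsSwap.fderiv_apply {Θ : Plane → Plane} {k l a b : ℝ} (h : IsSwap Θ k l a b)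
    (q v : Plane) : fderiv ℝ Θ q v 0 + fderiv ℝ Θ q v 1 = k * (v 0 - v 1) ∧
      fderiv ℝ Θ q v 0 - fderiv ℝ Θ q v 1 = l * (v 0 + v 1) := by
  rw [(hasFDerivAt_of_affine (isSwap_iff.1 h) q).fderiv]
  constructor <;> simp [Matrix.mulVec, dotProduct, Fin.sum_univ_two] <;> ring

lemma IsSimilarity.trans {Θ Θ' : Plane ≃ Plane} (h : IsSimilarity Θ) (h' : IsSimilarity Θ') :
    IsSimilarity (Θ.trans Θ') := by
  obtain ⟨k, l, a, b, hkl, h⟩ := h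
  obtain ⟨k', l', a', b', hkl', h'⟩ := h'
  rcases h with h | h <;> rcases h' with h' | h'
  · refine ⟨k' * k, l' * l, k' * a + a', l' * b + b', by nlinarith [mul_pos hkl hkl'], .inl ?_⟩
    constructor <;> intro q <;> simp only [Equiv.trans_apply, h'.sum, h'.diff, h.sum, h.diff] <;>
      ring
  · refine ⟨k' * l, l' * k, k' * b + a', l' * a + b', by nlinarith [mul_pos hkl hkl'], .inr ?_⟩
    constructor <;> intro q <;> simp only [Equiv.trans_apply, h'.sum, h'.diff, h.sum, h.diff] <;>
      ring
  · refine ⟨k' * k, l' * l, k' * a + a', l' * b + b', by nlinarith [mul_pos hkl hkl'], .inr ?_⟩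
    constructor <;> intro q <;> simp only [Equiv.trans_apply, h'.sum, h'.diff, h.sum, h.diff] <;>
      ring
  · refine ⟨k' * l, l' * k, k' * b + a', l' * a + b', by nlinarith [mul_pos hkl hkl'], .inl ?_⟩
    constructor <;> intro q <;> simp only [Equiv.trans_apply, h'.sum, h'.diff, h.sum, h.diff] <;>
      ring

lemma IsSimilarity.symm {Θ : Plane ≃ Plane} (h : IsSimilarity Θ) : IsSimilarity Θ.symm := by
  obtain ⟨k, l, a, b, hkl, h⟩ := h
  have hk : k ≠ 0 := left_ne_zero_of_mul hkl.ne'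
  have hl : l ≠ 0 := right_ne_zero_of_mul hkl.ne'
  rcases h with h | h
  · refine ⟨k⁻¹, l⁻¹, -a / k, -b / l, by rw [← mul_inv]; positivity, .inl ?_⟩
    constructor <;> intro q <;> obtain ⟨q, rfl⟩ := Θ.surjective q <;>
      simp only [Equiv.symm_apply_apply, h.sum, h.diff] <;> field_simp <;> ring
  · refine ⟨l⁻¹, k⁻¹, -b / l, -a / k, by rw [← mul_inv, mul_comm]; positivity, .inr ?_⟩
    constructor <;> intro q <;> obtain ⟨q, rfl⟩ := Θ.surjective q <;>
      simp only [Equiv.symm_apply_apply, h.sum, h.diff] <;> field_simp <;> ring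

lemma IsDilatation.isDirect {Ψ : Plane ≃ Plane} (h : IsDilatation Ψ) :
    ∃ s, 0 < s ∧ IsDirect Ψ s s 0 0 := by
  obtain ⟨s, hs, h⟩ := h
  refine ⟨s, hs, ?_⟩
  constructor <;> intro q <;> simp [h q] <;> ring

lemma IsDilatation.isSimilarity {Ψ : Plane ≃ Plane} (h : IsDilatation Ψ) : IsSimilarity Ψ :=
  let ⟨s, hs, h⟩ := h.isDirect
  ⟨s, s, 0, 0, mul_pos hs hs, .inl h⟩

lemma IsIsometry.isSimilarity {Φ : Plane ≃ Plane} (hΦ : IsIsometry Φ) : IsSimilarity Φ := by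
  obtain ⟨M, w, hM, h⟩ := hΦ.exists_affine
  have e := fun i j => congrFun (congrFun hM i) j
  have e00 := e 0 0
  have e01 := e 0 1
  have e11 := e 1 1
  simp [Matrix.mul_apply, Fin.sum_univ_two, metric] at e00 e01 e11
  obtain ⟨r, hr⟩ : ∃ r, r = M 0 0 + M 1 0 := ⟨_, rfl⟩
  obtain ⟨p, hp⟩ : ∃ p, p = M 0 0 - M 1 0 := ⟨_, rfl⟩
  obtain ⟨s, hs⟩ : ∃ s, s = M 0 1 + M 1 1 := ⟨_, rfl⟩
  obtain ⟨o, ho⟩ : ∃ o, o = M 0 1 - M 1 1 := ⟨_, rfl⟩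
  have hrp : r * p = 1 := by rw [hr, hp]; linear_combination e00
  have hso : s * o = -1 := by rw [hs, ho]; linear_combination e11
  have hx : r * o + p * s = 0 := by rw [hr, ho, hp, hs]; linear_combination 2 * e01
  -- Multiplying `r o + p s = 0` by `r s` and inserting `r p = 1`, `s o = -1` gives `s² = r²`. The
  -- sign decides whether the null coordinates are preserved or exchanged.
  have hs2 : (s - r) * (s + r) = 0 := by
    linear_combination (r * s) * hx - s ^ 2 * hrp - r ^ 2 * hso
  have hs0 : s ≠ 0 := by rintro rfl; simp at hso
  rcases mul_eq_zero.1 hs2 with h1 | h1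
  · have hsr : s = r := by linarith
    have hop : o = -p := by
      have : s * (o + p) = 0 := by rw [mul_add, hso]; nth_rw 1 [hsr]; rw [hrp]; ring
      have := (mul_eq_zero.1 this).resolve_left hs0
      linarith
    refine ⟨r, p, w 0 + w 1, w 0 - w 1, by rw [hrp]; norm_num, .inl ?_⟩
    constructor <;> intro q <;> rw [h q] <;>
      simp
    · linear_combination (-q 0) * hr - q 1 * hs + q 1 * hsr
    · linear_combination (-q 0) * hp - q 1 * ho + q 1 * hop
  · have hsr : s = -r := by linarith
    have hop : o = p := by
      have : s * (o - p) = 0 := by rw [mul_sub, hso]; nth_rw 1 [hsr]; linear_combination hrp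
      have := (mul_eq_zero.1 this).resolve_left hs0
      linarith
    refine ⟨r, p, w 0 + w 1, w 0 - w 1, by rw [hrp]; norm_num, .inr ?_⟩
    constructor <;> intro q <;> rw [h q] <;>
      simp
    · linear_combination (-q 0) * hr - q 1 * hs + q 1 * hsr
    · linear_combination (-q 0) * hp - q 1 * ho + q 1 * hop

/-! ### Similarities as isometries followed by dilatations -/

lemma isIsometry_of_mul_eq_one {Φ : Plane ≃ Plane} {k l a b : ℝ} (hkl : k * l = 1)
    (h : IsDirect Φ k l a b ∨ IsSwap Φ k l a b) : IsIsometry Φ where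
  smooth := IsSimilarity.contDiff ⟨k, l, a, b, by simp [hkl], h⟩
  smooth_symm := (IsSimilarity.symm ⟨k, l, a, b, by simp [hkl], h⟩).contDiff
  metric_eq q := by
    rcases h with h | h
    · rw [jacobian_of_affine (isDirect_iff.1 h)]
      ext i j
      fin_cases i <;> fin_cases j <;>
        simp [metric, Matrix.mul_apply, Fin.sum_univ_two] <;>
        first | linear_combination hkl | linear_combination (-1) * hkl | ring
    · rw [jacobian_of_affine (isSwap_iff.1 h)]
      ext i j
      fin_cases i <;> fin_cases j <;>
        simp [metric, Matrix.mul_apply, Fin.sum_univ_two] <;>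
        first | linear_combination hkl | linear_combination (-1) * hkl | ring

/-- The map of the plane given by `(u, v) ↦ (k u + a, l v + b)` in null coordinates. -/
noncomputable def directEquiv (k l a b : ℝ) (hk : k ≠ 0) (hl : l ≠ 0) : Plane ≃ Plane where
  toFun q := ![(k * (q 0 + q 1) + a + (l * (q 0 - q 1) + b)) / 2,
    (k * (q 0 + q 1) + a - (l * (q 0 - q 1) + b)) / 2]
  invFun q := ![((q 0 + q 1 - a) / k + (q 0 - q 1 - b) / l) / 2,
    ((q 0 + q 1 - a) / k - (q 0 - q 1 - b) / l) / 2]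
  left_inv q := by
    ext i; fin_cases i <;> simp <;> field_simp <;> ring
  right_inv q := by
    ext i; fin_cases i <;> simp <;> field_simp <;> ring

lemma isDirect_directEquiv {k l : ℝ} (a b : ℝ) (hk : k ≠ 0) (hl : l ≠ 0) :
    IsDirect (directEquiv k l a b hk hl) k l a b := by
  constructor <;> intro q <;> simp [directEquiv] <;> ring

/-- The reflection `(t, x) ↦ (t, -x)`. -/
def reflection : Plane ≃ Plane where
  toFun q := ![q 0, -q 1]
  invFun q := ![q 0, -q 1]
  left_inv q := by ext i; fin_cases i <;> simp
  right_inv q := by ext i; fin_cases i <;> simp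

lemma isSwap_reflection : IsSwap reflection 1 1 0 0 := by
  constructor <;> intro q <;> simp [reflection] <;> ring

lemma isDilatation_directEquiv {s : ℝ} (hs : 0 < s) :
    IsDilatation (directEquiv s s 0 0 hs.ne' hs.ne') := by
  refine ⟨s, hs, fun q => ?_⟩
  ext i; fin_cases i <;> simp [directEquiv] <;> ring

/-- The metric is `du dv`, so a similarity multiplies it by `k l`; dividing by the dilatation of
ratio `√(k l)` leaves an isometry. -/
lemma IsSimilarity.exists_eq_trans {Θ : Plane ≃ Plane} (h : IsSimilarity Θ) :
    ∃ Φ Ψ : Plane ≃ Plane, IsIsometry Φ ∧ IsDilatation Ψ ∧ Θ = Φ.trans Ψ := by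
  obtain ⟨k, l, a, b, hkl, h⟩ := h
  obtain ⟨s, hs, hss⟩ : ∃ s, 0 < s ∧ s * s = k * l :=
    ⟨√(k * l), Real.sqrt_pos.2 hkl, Real.mul_self_sqrt hkl.le⟩
  have hi := isDirect_directEquiv 0 0 (inv_pos.2 hs).ne' (inv_pos.2 hs).ne'
  have hj := isDirect_directEquiv 0 0 hs.ne' hs.ne'
  refine ⟨Θ.trans (directEquiv s⁻¹ s⁻¹ 0 0 (inv_pos.2 hs).ne' (inv_pos.2 hs).ne'),
    directEquiv s s 0 0 hs.ne' hs.ne', isIsometry_of_mul_eq_one (k := k / s) (l := l / s)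
      (a := a / s) (b := b / s) (by field_simp; linarith) ?_,
    isDilatation_directEquiv hs, ?_⟩
  · refine h.imp (fun h => ?_) (fun h => ?_) <;> constructor <;> intro q <;>
      simp only [Equiv.trans_apply, hi.sum, hi.diff, h.sum, h.diff] <;> field_simp <;> ring
  · ext q : 1
    have e : ∀ x y : Plane, x 0 + x 1 = y 0 + y 1 → x 0 - x 1 = y 0 - y 1 → x = y := by
      intro x y h1 h2
      ext i; fin_cases i <;> simp <;> linarith
    apply e <;> simp only [Equiv.trans_apply, hi.sum, hi.diff, hj.sum, hj.diff] <;>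
      field_simp <;> ring

/-! ### Push-forward in terms of null parameters -/

/-- The parameters of the Killing tensor with `K^{uu} = γ u² + 2 a u + c`,
`K^{vv} = γ v² + 2 b v + d` and `K^{uv} = e - γ u v - b u - a v` in null coordinates. -/
noncomputable def ofNull (γ a b c d e : ℝ) : Param where
  A := (c + d) / 4 + e / 2
  B := (c + d) / 4 - e / 2
  C := (c - d) / 4
  α := (a - b) / 2
  β := (a + b) / 2
  γ := γ

lemma exists_ofNull (p : Param) : ∃ γ a b c d e : ℝ, p = ofNull γ a b c d e :=
  ⟨p.γ, p.α + p.β, p.β - p.α, p.A + p.B + 2 * p.C, p.A + p.B - 2 * p.C, p.A - p.B, by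
    ext <;> simp only [ofNull] <;> ring⟩

/-- The new `K^{uu}` is `k² P((U - u) / k)`, and likewise for `K^{vv}` with `l` and `v`. The leading
coefficient `γ` does not change. -/
lemma pushforward_direct {Θ : Plane ≃ Plane} {k l u v : ℝ} (h : IsDirect Θ k l u v)
    (γ a b c d e : ℝ) : pushforward Θ (ofNull γ a b c d e).field =
      (ofNull γ (a * k - γ * u) (b * l - γ * v) (c * k ^ 2 - 2 * a * k * u + γ * u ^ 2)
        (d * l ^ 2 - 2 * b * l * v + γ * v ^ 2)
        (k * l * e - γ * u * v + b * l * u + a * k * v)).field := by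
  funext q
  obtain ⟨q, rfl⟩ := Θ.surjective q
  rw [pushforward, Equiv.symm_apply_apply, jacobian_of_affine (isDirect_iff.1 h)]
  rw [isDirect_iff.1 h q]
  ext i j
  fin_cases i <;> fin_cases j <;>
    simp [Param.field, ofNull, Matrix.mul_apply, dotProduct, Fin.sum_univ_two] <;>
    ring

lemma pushforward_swap {Θ : Plane ≃ Plane} {k l u v : ℝ} (h : IsSwap Θ k l u v)
    (γ a b c d e : ℝ) : pushforward Θ (ofNull γ a b c d e).field =
      (ofNull γ (b * k - γ * u) (a * l - γ * v) (d * k ^ 2 - 2 * b * k * u + γ * u ^ 2)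
        (c * l ^ 2 - 2 * a * l * v + γ * v ^ 2)
        (k * l * e - γ * u * v + a * l * u + b * k * v)).field := by
  funext q
  obtain ⟨q, rfl⟩ := Θ.surjective q
  rw [pushforward, Equiv.symm_apply_apply, jacobian_of_affine (isSwap_iff.1 h)]
  rw [isSwap_iff.1 h q]
  ext i j
  fin_cases i <;> fin_cases j <;>
    simp [Param.field, ofNull, Matrix.mul_apply, dotProduct, Fin.sum_univ_two] <;>
    ring

lemma field_add_metric (γ a b c d e τ : ℝ) :
    (fun q => (ofNull γ a b c d e).field q + τ • metric) =
      (ofNull γ a b c d (e + 2 * τ)).field := by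
  funext q
  ext i j
  fin_cases i <;> fin_cases j <;> simp [Param.field, ofNull, metric] <;> ring

lemma smul_field (γ a b c d e r : ℝ) :
    (fun q => r • (ofNull γ a b c d e).field q) =
      (ofNull (r * γ) (r * a) (r * b) (r * c) (r * d) (r * e)).field := by
  funext q
  ext i j
  fin_cases i <;> fin_cases j <;> simp [Param.field, ofNull] <;> ring

lemma IsKilling.exists_ofNull {K : TensorField} (hK : IsKilling K) :
    ∃ γ a b c d e : ℝ, K = (ofNull γ a b c d e).field := by
  obtain ⟨p, rfl⟩ := hK.exists_param
  obtain ⟨γ, a, b, c, d, e, rfl⟩ := Minkowski.exists_ofNull p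
  exact ⟨γ, a, b, c, d, e, rfl⟩

/-! ### The generators as permutations of the Killing tensors -/

lemma IsKilling.pushforward {K : TensorField} (hK : IsKilling K) {Θ : Plane ≃ Plane}
    (h : IsSimilarity Θ) : IsKilling (pushforward Θ K) := by
  obtain ⟨γ, a, b, c, d, e, rfl⟩ := hK.exists_ofNull
  obtain ⟨k, l, u, v, -, h | h⟩ := h
  · rw [pushforward_direct h]; exact Param.isKilling_field _
  · rw [pushforward_swap h]; exact Param.isKilling_field _

lemma jacobian_symm_mul {Θ : Plane ≃ Plane} (h : IsSimilarity Θ) (q : Plane) :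
    jacobian Θ.symm (Θ q) * jacobian Θ q = 1 := by
  have h1 := (h.symm.differentiable (Θ q)).hasFDerivAt.comp q (h.differentiable q).hasFDerivAt
  have h2 : Θ.symm ∘ Θ = id := by ext1 q; simp
  rw [h2] at h1
  have h3 := h1.unique (hasFDerivAt_id q)
  rw [jacobian, jacobian, ← LinearMap.toMatrix'_mul, ← LinearMap.toMatrix'_id]
  congr 1
  exact LinearMap.ext fun x => DFunLike.congr_fun h3 x

lemma pushforward_symm_pushforward {Θ : Plane ≃ Plane} (h : IsSimilarity Θ) (K : TensorField) :
    pushforward Θ.symm (pushforward Θ K) = K := by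
  funext q
  have h1 := jacobian_symm_mul h q
  simp only [pushforward, Equiv.symm_symm, Equiv.symm_apply_apply]
  calc _ = (jacobian Θ.symm (Θ q) * jacobian Θ q) * K q
        * (jacobian Θ.symm (Θ q) * jacobian Θ q).transpose := by
        simp only [Matrix.transpose_mul, Matrix.mul_assoc]
    _ = K q := by rw [h1]; simp

/-- The transformation of Killing tensors induced by a similarity. -/
noncomputable def pushforwardPerm (Θ : Plane ≃ Plane) (h : IsSimilarity Θ) :
    Equiv.Perm KillingTensor where
  toFun K := ⟨pushforward Θ K, K.2.pushforward h⟩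
  invFun K := ⟨pushforward Θ.symm K, K.2.pushforward h.symm⟩
  left_inv K := Subtype.ext (pushforward_symm_pushforward h K)
  right_inv K := Subtype.ext (pushforward_symm_pushforward h.symm K)

lemma IsKilling.add_metric {K : TensorField} (hK : IsKilling K) (τ : ℝ) :
    IsKilling (fun q => K q + τ • metric) := by
  obtain ⟨γ, a, b, c, d, e, rfl⟩ := hK.exists_ofNull
  rw [field_add_metric]; exact Param.isKilling_field _

lemma IsKilling.smul {K : TensorField} (hK : IsKilling K) (r : ℝ) :
    IsKilling (fun q => r • K q) := by
  obtain ⟨γ, a, b, c, d, e, rfl⟩ := hK.exists_ofNull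
  rw [smul_field]; exact Param.isKilling_field _

/-- Addition of a multiple of the metric. -/
def addMetricPerm (τ : ℝ) : Equiv.Perm KillingTensor where
  toFun K := ⟨_, K.2.add_metric τ⟩
  invFun K := ⟨_, K.2.add_metric (-τ)⟩
  left_inv K := by ext1; simp
  right_inv K := by ext1; simp

/-- Multiplication by a non-zero constant. -/
noncomputable def scalePerm (r : ℝ) (hr : r ≠ 0) : Equiv.Perm KillingTensor where
  toFun K := ⟨_, K.2.smul r⟩
  invFun K := ⟨_, K.2.smul r⁻¹⟩
  left_inv K := by ext1; simp [hr]
  right_inv K := by ext1; simp [hr]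

/-! ### Orbits -/

/-- The Killing tensor with given parameters. -/
def Param.tensor (p : Param) : KillingTensor := ⟨p.field, p.isKilling_field⟩

lemma orbit_eq_of_isGenerator {σ : Equiv.Perm KillingTensor} (hσ : IsGenerator σ)
    {K L : KillingTensor} (h : (σ K : TensorField) = L) :
    MulAction.orbit webGroup K = MulAction.orbit webGroup L := by
  refine (MulAction.orbit_eq_iff.2 ?_).symm
  exact ⟨⟨σ, Subgroup.subset_closure hσ⟩, Subtype.ext h⟩

/-- The orbit of the tensor with given parameters. -/
def Param.orbit (p : Param) : Set KillingTensor := MulAction.orbit webGroup p.tensor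

/-- Makes `e` irrelevant to the orbit. The lemmas below leave the final `e'` free for this reason.
-/
lemma orbit_addMetric (γ a b c d e e' : ℝ) :
    (ofNull γ a b c d e).orbit = (ofNull γ a b c d e').orbit := by
  refine orbit_eq_of_isGenerator (σ := addMetricPerm ((e' - e) / 2))
    (.addMetric _ fun _ => rfl) ?_
  refine (field_add_metric ..).trans ?_
  simp only [Param.tensor]
  ring_nf

lemma orbit_scale {r : ℝ} (hr : r ≠ 0) (γ a b c d e e' : ℝ) :
    (ofNull γ a b c d e).orbit = (ofNull (r * γ) (r * a) (r * b) (r * c) (r * d) e').orbit := by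
  rw [orbit_addMetric (r * γ) _ _ _ _ e' (r * e)]
  exact orbit_eq_of_isGenerator (σ := scalePerm r hr) (.scale r hr fun _ => rfl)
    (smul_field ..)

lemma orbit_swap (γ a b c d e e' : ℝ) :
    (ofNull γ a b c d e).orbit = (ofNull γ b a d c e').orbit := by
  rw [orbit_addMetric γ b a d c e' e]
  refine orbit_eq_of_isGenerator (σ := pushforwardPerm reflection
    ⟨1, 1, 0, 0, by norm_num, .inr isSwap_reflection⟩) (.isometry _ (isIsometry_of_mul_eq_one
      (one_mul 1) (.inr isSwap_reflection)) fun _ => rfl) ?_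
  refine (pushforward_swap isSwap_reflection ..).trans ?_
  simp [Param.tensor]

/-- Only isometries and dilatations are generators; a general similarity is reached by factoring it
and using the chain rule for Jacobians. -/
lemma orbit_pushforward {Θ : Plane ≃ Plane} (h : IsSimilarity Θ) (K : KillingTensor) :
    MulAction.orbit webGroup K = MulAction.orbit webGroup (pushforwardPerm Θ h K) := by
  obtain ⟨Φ, Ψ, hΦ, hΨ, rfl⟩ := h.exists_eq_trans
  have h1 := orbit_eq_of_isGenerator (.isometry Φ hΦ fun _ => rfl) (K := K)
    (σ := pushforwardPerm Φ hΦ.isSimilarity) (L := pushforwardPerm Φ hΦ.isSimilarity K) rfl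
  rw [h1]
  refine orbit_eq_of_isGenerator (.dilatation Ψ hΨ fun _ => rfl)
    (σ := pushforwardPerm Ψ hΨ.isSimilarity) ?_
  funext q
  obtain ⟨q, rfl⟩ := (Φ.trans Ψ).surjective q
  have hJ : jacobian (Φ.trans Ψ) q = jacobian Ψ (Φ q) * jacobian Φ q := by
    rw [jacobian, jacobian, jacobian, ← LinearMap.toMatrix'_mul]
    congr 1
    refine LinearMap.ext fun x => ?_
    have := (hΨ.isSimilarity.differentiable (Φ q)).hasFDerivAt.comp q
      (hΦ.isSimilarity.differentiable q).hasFDerivAt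
    exact DFunLike.congr_fun this.fderiv x
  simp only [pushforwardPerm, Equiv.coe_fn_mk, pushforward, Equiv.symm_apply_apply, hJ]
  simp only [Equiv.trans_apply, Equiv.symm_apply_apply, Matrix.transpose_mul, Matrix.mul_assoc]

lemma orbit_direct {k l : ℝ} (hkl : 0 < k * l) (u v γ a b c d e e' : ℝ) :
    (ofNull γ a b c d e).orbit = (ofNull γ (a * k - γ * u) (b * l - γ * v)
      (c * k ^ 2 - 2 * a * k * u + γ * u ^ 2)
      (d * l ^ 2 - 2 * b * l * v + γ * v ^ 2) e').orbit := by
  rw [orbit_addMetric γ (a * k - γ * u) _ _ _ e'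
    (k * l * e - γ * u * v + b * l * u + a * k * v)]
  have h := isDirect_directEquiv u v (left_ne_zero_of_mul hkl.ne') (right_ne_zero_of_mul hkl.ne')
  have hs : IsSimilarity (directEquiv k l u v (left_ne_zero_of_mul hkl.ne')
    (right_ne_zero_of_mul hkl.ne')) := ⟨k, l, u, v, hkl, .inl h⟩
  refine (orbit_pushforward hs _).trans ?_
  rw [Param.orbit]
  congr 1
  exact Subtype.ext (pushforward_direct h ..)

/-! ### Normal forms -/

lemma exists_sq_mul_eq_sign (x : ℝ) : ∃ k, 0 < k ∧ x * k ^ 2 = Real.sign x := by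
  rcases lt_trichotomy x 0 with h | rfl | h
  · refine ⟨(√(-x))⁻¹, inv_pos.2 (Real.sqrt_pos.2 (by linarith)), ?_⟩
    rw [inv_pow, Real.sq_sqrt (by linarith), Real.sign_of_neg h, inv_neg, mul_neg,
      mul_inv_cancel₀ h.ne]
  · exact ⟨1, one_pos, by simp⟩
  · refine ⟨(√x)⁻¹, inv_pos.2 (Real.sqrt_pos.2 h), ?_⟩
    rw [inv_pow, Real.sq_sqrt h.le, Real.sign_of_pos h]
    field_simp

lemma orbit_of_gamma_ne_zero {γ : ℝ} (hγ : γ ≠ 0) (a b c d e : ℝ) :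
    (ofNull γ a b c d e).orbit =
      (ofNull 1 0 0 (γ * c - a ^ 2).sign (γ * d - b ^ 2).sign 0).orbit := by
  obtain ⟨k, hk, hk'⟩ := exists_sq_mul_eq_sign (γ * c - a ^ 2)
  obtain ⟨l, hl, hl'⟩ := exists_sq_mul_eq_sign (γ * d - b ^ 2)
  -- Divide by `γ`, complete both squares by translating, then rescale `u` and `v` separately. The
  -- factor `|γ|` absorbs the `γ²` in the denominator of `(γ c - a²) / γ²` while keeping the scale
  -- factors positive.
  rw [← hk', ← hl', orbit_scale (inv_ne_zero hγ) γ a b c d e 0,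
    orbit_direct (one_mul (1 : ℝ) ▸ one_pos) (a / γ) (b / γ) _ _ _ _ _ _ 0,
    orbit_direct (k := k * |γ|) (l := l * |γ|) (by positivity) 0 0 _ _ _ _ _ _ 0]
  congr 1
  simp only [mul_pow, sq_abs]
  congr 1 <;> field_simp <;> ring

/-- Translations remove the constants, and rescaling makes the slopes `±1`. The condition `k l > 0`
means that the sign of `a b` survives, which is what separates M7 from M8. -/
lemma orbit_of_mul_ne_zero {a b : ℝ} (ha : a ≠ 0) (hb : b ≠ 0) (c d e : ℝ) :
    (ofNull 0 a b c d e).orbit = (ofNull 0 1 (a * b).sign 0 0 0).orbit := by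
  obtain ⟨s, hs, hs'⟩ : ∃ s, 0 < a * b * s ∧ s = (a * b).sign := by
    refine ⟨_, ?_, rfl⟩
    rw [mul_comm]
    exact Real.sign_mul_pos_of_ne_zero _ (mul_ne_zero ha hb)
  have hs0 : s ≠ 0 := right_ne_zero_of_mul hs.ne'
  rw [← hs', orbit_direct (k := a⁻¹) (l := s / b) (by
    have : a⁻¹ * (s / b) = a * b * s / (a * b) ^ 2 := by field_simp
    rw [this]; positivity) (c / (2 * a ^ 2)) (d * s / (2 * b ^ 2)) _ _ _ _ _ _ 0]
  congr 1
  congr 1 <;> field_simp <;> ring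

lemma orbit_of_right_eq_zero {a : ℝ} (ha : a ≠ 0) (c : ℝ) {d : ℝ} (hd : d ≠ 0) (e : ℝ) :
    (ofNull 0 a 0 c d e).orbit = (ofNull 0 1 0 0 1 0).orbit := by
  have hs : a / d ≠ 0 := div_ne_zero ha hd
  rw [orbit_scale (inv_ne_zero hd) _ _ _ _ _ _ 0,
    -- With `d` already equal to `1`, `k` normalises the slope. The choice `l = ±1` restores `k l >
    -- 0` without changing the constant of `K^{vv}`.
    orbit_direct (k := (a / d)⁻¹) (l := (a / d).sign) (by
      rw [← Real.sign_inv, mul_comm]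
      exact Real.sign_mul_pos_of_ne_zero _ (inv_ne_zero hs)) (c * d / (2 * a ^ 2)) 0
        _ _ _ _ _ _ 0]
  have h1 : (a / d).sign ^ 2 = 1 := by
    rcases Real.sign_apply_eq_of_ne_zero _ hs with h | h <;> rw [h] <;> norm_num
  rw [h1]
  congr 1
  congr 1 <;> field_simp <;> ring

lemma orbit_of_right_eq_zero_of_eq_zero {a : ℝ} (ha : a ≠ 0) (c e : ℝ) :
    (ofNull 0 a 0 c 0 e).orbit = (ofNull 0 1 0 0 0 0).orbit := by
  rw [orbit_direct (k := a⁻¹) (l := a⁻¹) (mul_self_pos.2 (inv_ne_zero ha)) (c / (2 * a ^ 2)) 0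
        _ _ _ _ _ _ 0]
  congr 1
  congr 1 <;> field_simp <;> ring

lemma orbit_of_const {c : ℝ} (hc : c ≠ 0) (d e : ℝ) :
    (ofNull 0 0 0 c d e).orbit = (ofNull 0 0 0 1 (c * d).sign 0).orbit := by
  obtain ⟨l, hl, hl'⟩ := exists_sq_mul_eq_sign (c * d)
  rw [← hl', orbit_scale (inv_ne_zero hc) _ _ _ _ _ _ 0,
    orbit_direct (k := 1) (l := l * |c|) (by positivity) 0 0 _ _ _ _ _ _ 0]
  congr 1
  simp only [mul_pow, sq_abs]
  congr 1 <;> field_simp <;> ring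

/-! ### The fourteen classes in terms of null parameters -/

/-- The conditions on `γ`, `a`, `b`, `c`, `d` that describe the classes. -/
def nullClass (γ a b c d : ℝ) : OrbitName → Prop
  | .M1 => γ ≠ 0 ∧ 0 < γ * c - a ^ 2 ∧ 0 < γ * d - b ^ 2
  | .M2 => γ ≠ 0 ∧ (γ * c - a ^ 2) * (γ * d - b ^ 2) < 0
  | .M3 => γ ≠ 0 ∧ γ * c - a ^ 2 < 0 ∧ γ * d - b ^ 2 < 0
  | .M4 => γ ≠ 0 ∧ ((γ * c - a ^ 2 = 0 ∧ 0 < γ * d - b ^ 2) ∨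
      (0 < γ * c - a ^ 2 ∧ γ * d - b ^ 2 = 0))
  | .M5 => γ ≠ 0 ∧ ((γ * c - a ^ 2 = 0 ∧ γ * d - b ^ 2 < 0) ∨
      (γ * c - a ^ 2 < 0 ∧ γ * d - b ^ 2 = 0))
  | .M6 => γ ≠ 0 ∧ γ * c - a ^ 2 = 0 ∧ γ * d - b ^ 2 = 0
  | .M7 => γ = 0 ∧ a * b < 0
  | .M8 => γ = 0 ∧ 0 < a * b
  | .M9 => γ = 0 ∧ ((a ≠ 0 ∧ b = 0 ∧ d ≠ 0) ∨ (a = 0 ∧ b ≠ 0 ∧ c ≠ 0))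
  | .M10 => γ = 0 ∧ ((a ≠ 0 ∧ b = 0 ∧ d = 0) ∨ (a = 0 ∧ b ≠ 0 ∧ c = 0))
  | .M11 => γ = 0 ∧ a = 0 ∧ b = 0 ∧ 0 < c * d
  | .M12 => γ = 0 ∧ a = 0 ∧ b = 0 ∧ c * d < 0
  | .M13 => γ = 0 ∧ a = 0 ∧ b = 0 ∧ ((c = 0 ∧ d ≠ 0) ∨ (c ≠ 0 ∧ d = 0))
  | .M14 => γ = 0 ∧ a = 0 ∧ b = 0 ∧ c = 0 ∧ d = 0

section

variable (γ a b c d e : ℝ)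

/-- Minus a quarter of the discriminant of `K^{uu}`; `Zpos` plays the same role for `K^{vv}`. -/
lemma Zneg_ofNull : (ofNull γ a b c d e).Zneg = γ * c - a ^ 2 := by
  simp only [ofNull, Param.Zneg]; ring

lemma Zpos_ofNull : (ofNull γ a b c d e).Zpos = γ * d - b ^ 2 := by
  simp only [ofNull, Param.Zpos]; ring

lemma ofNull_mem_S₃ : ofNull γ a b c d e ∈ Param.S₃ ↔
    γ * c - a ^ 2 = 0 ∧ γ * d - b ^ 2 = 0 := by
  simp only [ofNull, Param.S₃, Set.mem_ofPred_eq]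
  constructor <;> rintro ⟨h1, h2⟩ <;> constructor <;> linarith

lemma ofNull_mem_S₄ : ofNull γ a b c d e ∈ Param.S₄ ↔
    γ = 0 ∧ ((b = 0 ∧ d = 0) ∨ (a = 0 ∧ c = 0)) := by
  have h1 : (a - b) / 2 = (a + b) / 2 ↔ b = 0 := by constructor <;> intro h <;> linarith
  have h2 : (a - b) / 2 = -((a + b) / 2) ↔ a = 0 := by constructor <;> intro h <;> linarith
  have h3 : (c + d) / 4 + e / 2 + ((c + d) / 4 - e / 2) = 2 * ((c - d) / 4) ↔ d = 0 := by
    constructor <;> intro h <;> linarith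
  have h4 : (c + d) / 4 + e / 2 + ((c + d) / 4 - e / 2) = -2 * ((c - d) / 4) ↔ c = 0 := by
    constructor <;> intro h <;> linarith
  simp only [ofNull, Param.S₄, Set.mem_union, Set.mem_ofPred_eq, h1, h2, h3, h4]
  tauto

lemma ofNull_mem_S₅ : ofNull γ a b c d e ∈ Param.S₅ ↔
    γ = 0 ∧ a = 0 ∧ b = 0 ∧ c = 0 ∧ d = 0 := by
  simp only [ofNull, Param.S₅, Set.mem_ofPred_eq]
  constructor
  · rintro ⟨h1, h2, h3, h4, h5⟩
    refine ⟨?_, ?_, ?_, ?_, ?_⟩ <;> linarith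
  · rintro ⟨rfl, rfl, rfl, rfl, rfl⟩
    refine ⟨?_, ?_, ?_, ?_, ?_⟩ <;> ring

lemma ofNull_mem_params (m : OrbitName) :
    ofNull γ a b c d e ∈ m.params ↔ nullClass γ a b c d m := by
  have hS1 : ofNull γ a b c d e ∈ Param.S₁ ↔ γ = 0 := Iff.rfl
  have hS2 : ofNull γ a b c d e ∈ Param.S₂ ↔ γ * c - a ^ 2 = 0 ∨ γ * d - b ^ 2 = 0 := by
    rw [Param.S₂, Set.mem_ofPred_eq, Zneg_ofNull, Zpos_ofNull, mul_eq_zero, or_comm]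
  have hab : (ofNull γ a b c d e).α ^ 2 - (ofNull γ a b c d e).β ^ 2 = -(a * b) := by
    simp only [ofNull]; ring
  have hcd : (2 * (ofNull γ a b c d e).C) ^ 2
      - ((ofNull γ a b c d e).A + (ofNull γ a b c d e).B) ^ 2 = -(c * d) := by
    simp only [ofNull]; ring
  have hγ : γ = 0 → γ * c - a ^ 2 = -a ^ 2 ∧ γ * d - b ^ 2 = -b ^ 2 := by
    rintro rfl; constructor <;> ring
  have ha : -a ^ 2 = 0 ↔ a = 0 := by simp
  have hb : -b ^ 2 = 0 ↔ b = 0 := by simp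
  cases m <;> simp only [OrbitName.params, nullClass, Set.mem_inter_iff, Set.mem_sdiff,
    Set.mem_union, Set.mem_compl_iff, Set.mem_ofPred_eq, hS1, hS2, ofNull_mem_S₃, ofNull_mem_S₄,
    ofNull_mem_S₅, Zneg_ofNull, Zpos_ofNull, mul_neg_iff]
  all_goals generalize γ * c - a ^ 2 = X at *
  all_goals generalize γ * d - b ^ 2 = Y at *
  case M7 =>
    rw [← mul_neg_iff]; grind
  case M11 => grind [mul_eq_zero]
  case M12 => rw [← mul_neg_iff]; grind [mul_eq_zero]
  all_goals grind

end

lemma exists_nullClass (γ a b c d : ℝ) : ∃ m, nullClass γ a b c d m := by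
  by_cases hγ : γ = 0
  · by_cases hab : a * b = 0
    · by_cases hcd : c * d = 0
      · by_cases h : (a = 0 ∧ b = 0)
        · by_cases h' : (c = 0 ∧ d = 0)
          · exact ⟨.M14, by simp only [nullClass]; tauto⟩
          · exact ⟨.M13, by have := mul_eq_zero.1 hcd; simp only [nullClass]; tauto⟩
        · by_cases h' : (a ≠ 0 ∧ d = 0) ∨ (b ≠ 0 ∧ c = 0)
          · exact ⟨.M10, by have := mul_eq_zero.1 hab; simp only [nullClass]; tauto⟩
          · exact ⟨.M9, by have := mul_eq_zero.1 hab; simp only [nullClass]; tauto⟩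
      · obtain ⟨hc, hd⟩ := mul_ne_zero_iff.1 hcd
        by_cases h : (a = 0 ∧ b = 0)
        · rcases lt_or_gt_of_ne hcd with h' | h'
          · exact ⟨.M12, hγ, h.1, h.2, h'⟩
          · exact ⟨.M11, hγ, h.1, h.2, h'⟩
        · exact ⟨.M9, by have := mul_eq_zero.1 hab; simp only [nullClass]; tauto⟩
    · rcases lt_or_gt_of_ne hab with h' | h'
      · exact ⟨.M7, hγ, h'⟩
      · exact ⟨.M8, hγ, h'⟩
  · rcases lt_trichotomy (γ * c - a ^ 2) 0 with hX | hX | hX <;>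
      rcases lt_trichotomy (γ * d - b ^ 2) 0 with hY | hY | hY
    · exact ⟨.M3, hγ, hX, hY⟩
    · exact ⟨.M5, hγ, .inr ⟨hX, hY⟩⟩
    · exact ⟨.M2, hγ, mul_neg_of_neg_of_pos hX hY⟩
    · exact ⟨.M5, hγ, .inl ⟨hX, hY⟩⟩
    · exact ⟨.M6, hγ, hX, hY⟩
    · exact ⟨.M4, hγ, .inl ⟨hX, hY⟩⟩
    · exact ⟨.M2, hγ, mul_neg_of_pos_of_neg hX hY⟩
    · exact ⟨.M4, hγ, .inr ⟨hX, hY⟩⟩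
    · exact ⟨.M1, hγ, hX, hY⟩

lemma nullClass_unique {γ a b c d : ℝ} {m m' : OrbitName} (h : nullClass γ a b c d m)
    (h' : nullClass γ a b c d m') : m = m' := by
  cases m <;> cases m' <;> first
    | rfl
    | (exfalso; revert h h'; simp only [nullClass, mul_neg_iff, mul_pos_iff]; grind)

/-! ### Invariance of the classes -/

lemma nullClass_swap {γ a b c d : ℝ} {m : OrbitName} (h : nullClass γ a b c d m) :
    nullClass γ b a d c m := by
  cases m <;> simp only [nullClass] at h ⊢
  case M2 | M7 | M8 | M11 | M12 =>
    rw [mul_comm]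
    first | exact h | exact ⟨h.1, h.2.2.1, h.2.1, h.2.2.2⟩
  all_goals tauto

lemma mul_neg_iff_of_pos_left {x y : ℝ} (hx : 0 < x) : x * y < 0 ↔ y < 0 := by
  rw [← not_le, ← not_le, mul_nonneg_iff_of_pos_left hx]

/-- Collects what the classes depend on: the vanishing of `γ`, the signs of the two discriminants
and, where `γ = 0`, the signs of `a b` and `c d` and the vanishing of single constants. The last
conditions are required only where the slopes involved vanish, since a translation changes a
constant whose slope is non-zero. -/
lemma nullClass_congr {γ a b c d γ' a' b' c' d' x y : ℝ} (hx : 0 < x) (hy : 0 < y)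
    (hγ : γ' = 0 ↔ γ = 0) (hX : γ' * c' - a' ^ 2 = x * (γ * c - a ^ 2))
    (hY : γ' * d' - b' ^ 2 = y * (γ * d - b ^ 2))
    (hab : γ = 0 → ∃ z, 0 < z ∧ a' * b' = z * (a * b))
    (hcd : γ = 0 → a = 0 → b = 0 → ∃ z, 0 < z ∧ c' * d' = z * (c * d))
    (hc : γ = 0 → a = 0 → (c' = 0 ↔ c = 0)) (hd : γ = 0 → b = 0 → (d' = 0 ↔ d = 0))
    {m : OrbitName} (h : nullClass γ a b c d m) : nullClass γ' a' b' c' d' m := by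
  have hX0 : x * (γ * c - a ^ 2) = 0 ↔ γ * c - a ^ 2 = 0 := by simp [hx.ne']
  have hY0 : y * (γ * d - b ^ 2) = 0 ↔ γ * d - b ^ 2 = 0 := by simp [hy.ne']
  have hXY : x * (γ * c - a ^ 2) * (y * (γ * d - b ^ 2))
    = x * y * ((γ * c - a ^ 2) * (γ * d - b ^ 2)) := by ring
  have ha : γ = 0 → (a' = 0 ↔ a = 0) := by
    rintro rfl
    rw [hγ.2 rfl] at hX
    have : a' ^ 2 = x * a ^ 2 := by linarith
    rw [← sq_eq_zero_iff, this]; simp [hx.ne']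
  have hb : γ = 0 → (b' = 0 ↔ b = 0) := by
    rintro rfl
    rw [hγ.2 rfl] at hY
    have : b' ^ 2 = y * b ^ 2 := by linarith
    rw [← sq_eq_zero_iff, this]; simp [hy.ne']
  cases m <;> simp only [nullClass, hX, hY, hγ, hX0, hY0, hXY, mul_pos_iff_of_pos_left hx,
    mul_pos_iff_of_pos_left hy, mul_neg_iff_of_pos_left hx, mul_neg_iff_of_pos_left hy, ne_eq,
    mul_neg_iff_of_pos_left (mul_pos hx hy)] at h ⊢
  case M7 | M8 =>
    obtain ⟨z, hz, e⟩ := hab h.1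
    simpa only [e, mul_pos_iff_of_pos_left hz, mul_neg_iff_of_pos_left hz] using h
  case M11 | M12 =>
    obtain ⟨z, hz, e⟩ := hcd h.1 h.2.1 h.2.2.1
    simpa only [e, mul_pos_iff_of_pos_left hz, mul_neg_iff_of_pos_left hz, ha h.1, hb h.1] using h
  case M9 =>
    exact ⟨h.1, h.2.imp (fun h' => ⟨mt (ha h.1).1 h'.1, (hb h.1).2 h'.2.1,
      mt (hd h.1 h'.2.1).1 h'.2.2⟩) (fun h' => ⟨(ha h.1).2 h'.1, mt (hb h.1).1 h'.2.1,
      mt (hc h.1 h'.1).1 h'.2.2⟩)⟩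
  case M10 =>
    exact ⟨h.1, h.2.imp (fun h' => ⟨mt (ha h.1).1 h'.1, (hb h.1).2 h'.2.1,
      (hd h.1 h'.2.1).2 h'.2.2⟩) (fun h' => ⟨(ha h.1).2 h'.1, mt (hb h.1).1 h'.2.1,
      (hc h.1 h'.1).2 h'.2.2⟩)⟩
  case M13 | M14 =>
    simpa only [ha h.1, hb h.1, hc h.1 h.2.1, hd h.1 h.2.2.1] using h
  all_goals exact h

lemma nullClass_direct {γ a b c d k l : ℝ} (hkl : 0 < k * l) (u v : ℝ) {m : OrbitName}
    (h : nullClass γ a b c d m) : nullClass γ (a * k - γ * u) (b * l - γ * v)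
      (c * k ^ 2 - 2 * a * k * u + γ * u ^ 2) (d * l ^ 2 - 2 * b * l * v + γ * v ^ 2) m := by
  have hk : k ≠ 0 := left_ne_zero_of_mul hkl.ne'
  have hl : l ≠ 0 := right_ne_zero_of_mul hkl.ne'
  refine nullClass_congr (x := k ^ 2) (y := l ^ 2) (by positivity) (by positivity) Iff.rfl
    (by ring) (by ring) ?_ ?_ ?_ ?_ h
  · rintro rfl; exact ⟨k * l, hkl, by ring⟩
  · rintro rfl rfl rfl; exact ⟨k ^ 2 * l ^ 2, by positivity, by ring⟩
  · rintro rfl rfl; simp [hk]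
  · rintro rfl rfl; simp [hl]

lemma nullClass_scale {γ a b c d r : ℝ} (hr : r ≠ 0) {m : OrbitName}
    (h : nullClass γ a b c d m) : nullClass (r * γ) (r * a) (r * b) (r * c) (r * d) m := by
  have h2 : 0 < r ^ 2 := by positivity
  refine nullClass_congr (x := r ^ 2) (y := r ^ 2) h2 h2 (by simp [hr])
    (by ring) (by ring) ?_ ?_ ?_ ?_ h
  · rintro rfl; exact ⟨r ^ 2, h2, by ring⟩
  · rintro rfl rfl rfl; exact ⟨r ^ 2, h2, by ring⟩
  · rintro rfl rfl; simp [hr]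
  · rintro rfl rfl; simp [hr]

/-! ### The orbits are the classes -/

lemma mem_tensors_iff_of_eq {K : KillingTensor} {γ a b c d e : ℝ}
    (hK : (K : TensorField) = (ofNull γ a b c d e).field) (m : OrbitName) :
    K ∈ m.tensors ↔ nullClass γ a b c d m := by
  rw [← ofNull_mem_params γ a b c d e]
  constructor
  · rintro ⟨p, hp, h⟩
    rwa [Param.field_injective (hK.symm.trans h)]
  · exact fun h => ⟨_, h, hK⟩

lemma ofNull_tensor_mem_tensors (γ a b c d e : ℝ) (m : OrbitName) :
    (ofNull γ a b c d e).tensor ∈ m.tensors ↔ nullClass γ a b c d m :=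
  mem_tensors_iff_of_eq rfl m

lemma exists_ofNull_tensor (K : KillingTensor) :
    ∃ γ a b c d e : ℝ, K = (ofNull γ a b c d e).tensor :=
  let ⟨γ, a, b, c, d, e, h⟩ := K.2.exists_ofNull
  ⟨γ, a, b, c, d, e, Subtype.ext h⟩

lemma exists_mem_tensors (K : KillingTensor) : ∃ m : OrbitName, K ∈ m.tensors := by
  obtain ⟨γ, a, b, c, d, e, rfl⟩ := exists_ofNull_tensor K
  obtain ⟨m, hm⟩ := exists_nullClass γ a b c d
  exact ⟨m, (ofNull_tensor_mem_tensors ..).2 hm⟩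

lemma eq_of_mem_tensors {K : KillingTensor} {m m' : OrbitName} (h : K ∈ m.tensors)
    (h' : K ∈ m'.tensors) : m = m' := by
  obtain ⟨γ, a, b, c, d, e, rfl⟩ := exists_ofNull_tensor K
  rw [ofNull_tensor_mem_tensors] at h h'
  exact nullClass_unique h h'

lemma pushforward_mem_tensors {Θ : Plane ≃ Plane} (hΘ : IsSimilarity Θ) {K L : KillingTensor}
    (hL : (L : TensorField) = pushforward Θ K) {m : OrbitName} (h : K ∈ m.tensors) :
    L ∈ m.tensors := by
  obtain ⟨γ, a, b, c, d, e, rfl⟩ := exists_ofNull_tensor K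
  rw [ofNull_tensor_mem_tensors] at h
  obtain ⟨k, l, u, v, hkl, hΘ | hΘ⟩ := hΘ
  · exact (mem_tensors_iff_of_eq (hL.trans (pushforward_direct hΘ ..)) m).2
      (nullClass_direct hkl u v h)
  · exact (mem_tensors_iff_of_eq (hL.trans (pushforward_swap hΘ ..)) m).2
      (nullClass_direct hkl u v (nullClass_swap h))

lemma IsGenerator.mem_tensors {σ : Equiv.Perm KillingTensor} (hσ : IsGenerator σ)
    {K : KillingTensor} {m : OrbitName} (h : K ∈ m.tensors) : σ K ∈ m.tensors := by
  cases hσ with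
  | isometry Φ hΦ hσ => exact pushforward_mem_tensors hΦ.isSimilarity (hσ K) h
  | dilatation Φ hΦ hσ => exact pushforward_mem_tensors hΦ.isSimilarity (hσ K) h
  | addMetric τ hσ =>
    obtain ⟨γ, a, b, c, d, e, rfl⟩ := exists_ofNull_tensor K
    rw [ofNull_tensor_mem_tensors] at h
    exact (mem_tensors_iff_of_eq ((hσ _).trans (field_add_metric γ a b c d e τ)) m).2 h
  | scale r hr hσ =>
    obtain ⟨γ, a, b, c, d, e, rfl⟩ := exists_ofNull_tensor K
    rw [ofNull_tensor_mem_tensors] at h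
    exact (mem_tensors_iff_of_eq ((hσ _).trans (smul_field γ a b c d e r)) m).2
      (nullClass_scale hr h)

lemma mem_tensors_of_mem_webGroup {σ : Equiv.Perm KillingTensor} (hσ : σ ∈ webGroup)
    {K : KillingTensor} {m : OrbitName} (h : K ∈ m.tensors) : σ K ∈ m.tensors := by
  induction hσ using Subgroup.closure_induction generalizing K m with
  | mem σ hσ => exact hσ.mem_tensors h
  | one => exact h
  | mul σ τ _ _ h1 h2 => exact h1 (h2 h)
  | inv σ _ h1 =>
    -- As the classes partition the space, a permutation preserving each of them has an inverse that
    -- does too: the class of the preimage is carried to itself, so it is the class of `K`.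
    obtain ⟨m', h'⟩ := exists_mem_tensors (σ⁻¹ K)
    have : σ (σ⁻¹ K) ∈ m'.tensors := h1 h'
    rw [show σ (σ⁻¹ K) = K from σ.apply_symm_apply K] at this
    rwa [eq_of_mem_tensors h this]

/-- The null parameters of a normal form for each class. -/
noncomputable def normalForm : OrbitName → Param
  | .M1 => ofNull 1 0 0 1 1 0
  | .M2 => ofNull 1 0 0 1 (-1) 0
  | .M3 => ofNull 1 0 0 (-1) (-1) 0
  | .M4 => ofNull 1 0 0 1 0 0
  | .M5 => ofNull 1 0 0 (-1) 0 0
  | .M6 => ofNull 1 0 0 0 0 0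
  | .M7 => ofNull 0 1 (-1) 0 0 0
  | .M8 => ofNull 0 1 1 0 0 0
  | .M9 => ofNull 0 1 0 0 1 0
  | .M10 => ofNull 0 1 0 0 0 0
  | .M11 => ofNull 0 0 0 1 1 0
  | .M12 => ofNull 0 0 0 1 (-1) 0
  | .M13 => ofNull 0 0 0 1 0 0
  | .M14 => ofNull 0 0 0 0 0 0

lemma normalForm_mem (m : OrbitName) : (normalForm m).tensor ∈ m.tensors := by
  cases m <;> simp only [normalForm] <;> rw [ofNull_tensor_mem_tensors] <;> norm_num [nullClass]

lemma orbit_eq_normalForm {γ a b c d : ℝ} (e : ℝ) {m : OrbitName} (h : nullClass γ a b c d m) :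
    (ofNull γ a b c d e).orbit = (normalForm m).orbit := by
  cases m <;> simp only [nullClass, normalForm] at h ⊢
  case M1 =>
    rw [orbit_of_gamma_ne_zero h.1, Real.sign_of_pos h.2.1, Real.sign_of_pos h.2.2]
  case M2 =>
    rw [orbit_of_gamma_ne_zero h.1]
    rcases mul_neg_iff.1 h.2 with ⟨h1, h2⟩ | ⟨h1, h2⟩
    · rw [Real.sign_of_pos h1, Real.sign_of_neg h2]
    · rw [Real.sign_of_neg h1, Real.sign_of_pos h2, orbit_swap]
  case M3 =>
    rw [orbit_of_gamma_ne_zero h.1, Real.sign_of_neg h.2.1, Real.sign_of_neg h.2.2]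
  case M4 =>
    rw [orbit_of_gamma_ne_zero h.1]
    rcases h.2 with ⟨h1, h2⟩ | ⟨h1, h2⟩
    · rw [h1, Real.sign_of_pos h2, Real.sign_zero, orbit_swap]
    · rw [h2, Real.sign_of_pos h1, Real.sign_zero]
  case M5 =>
    rw [orbit_of_gamma_ne_zero h.1]
    rcases h.2 with ⟨h1, h2⟩ | ⟨h1, h2⟩
    · rw [h1, Real.sign_of_neg h2, Real.sign_zero, orbit_swap]
    · rw [h2, Real.sign_of_neg h1, Real.sign_zero]
  case M6 =>
    rw [orbit_of_gamma_ne_zero h.1, h.2.1, h.2.2, Real.sign_zero]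
  case M7 =>
    obtain ⟨ha, hb⟩ := mul_ne_zero_iff.1 h.2.ne
    rw [h.1, orbit_of_mul_ne_zero ha hb, Real.sign_of_neg h.2]
  case M8 =>
    obtain ⟨ha, hb⟩ := mul_ne_zero_iff.1 h.2.ne'
    rw [h.1, orbit_of_mul_ne_zero ha hb, Real.sign_of_pos h.2]
  case M9 =>
    obtain ⟨rfl, ⟨ha, rfl, hd⟩ | ⟨rfl, hb, hc⟩⟩ := h
    · rw [orbit_of_right_eq_zero ha c hd]
    · rw [orbit_swap _ _ _ _ _ _ 0, orbit_of_right_eq_zero hb d hc]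
  case M10 =>
    obtain ⟨rfl, ⟨ha, rfl, rfl⟩ | ⟨rfl, hb, rfl⟩⟩ := h
    · rw [orbit_of_right_eq_zero_of_eq_zero ha c]
    · rw [orbit_swap _ _ _ _ _ _ 0, orbit_of_right_eq_zero_of_eq_zero hb d]
  case M11 =>
    obtain ⟨rfl, rfl, rfl, h⟩ := h
    rw [orbit_of_const (left_ne_zero_of_mul h.ne'), Real.sign_of_pos h]
  case M12 =>
    obtain ⟨rfl, rfl, rfl, h⟩ := h
    rw [orbit_of_const (left_ne_zero_of_mul h.ne), Real.sign_of_neg h]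
  case M13 =>
    obtain ⟨rfl, rfl, rfl, ⟨rfl, hd⟩ | ⟨hc, rfl⟩⟩ := h
    · rw [orbit_swap _ _ _ _ _ _ 0, orbit_of_const hd, mul_zero, Real.sign_zero]
    · rw [orbit_of_const hc, mul_zero, Real.sign_zero]
  case M14 =>
    obtain ⟨rfl, rfl, rfl, rfl, rfl⟩ := h
    exact orbit_addMetric ..

/-- Invariance of the class gives one inclusion; a common normal form for all its members gives the
other. -/
lemma orbit_eq_tensors {K : KillingTensor} {m : OrbitName} (h : K ∈ m.tensors) :
    MulAction.orbit webGroup K = m.tensors := by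
  have key : ∀ {L : KillingTensor}, L ∈ m.tensors →
      MulAction.orbit webGroup L = (normalForm m).orbit := by
    intro L hL
    obtain ⟨γ, a, b, c, d, e, rfl⟩ := exists_ofNull_tensor L
    exact orbit_eq_normalForm e ((ofNull_tensor_mem_tensors ..).1 hL)
  ext L
  constructor
  · rintro ⟨σ, rfl⟩
    exact mem_tensors_of_mem_webGroup σ.2 h
  · intro hL
    rw [key h, ← key hL]
    exact MulAction.mem_orbit_self L

lemma tensors_injective : Function.Injective OrbitName.tensors := by
  intro m m' h
  have := normalForm_mem m
  exact eq_of_mem_tensors this (h ▸ this)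

lemma range_orbit : Set.range (fun K : KillingTensor => MulAction.orbit webGroup K) =
    Set.range OrbitName.tensors := by
  ext S
  constructor
  · rintro ⟨K, rfl⟩
    obtain ⟨m, hm⟩ := exists_mem_tensors K
    exact ⟨m, (orbit_eq_tensors hm).symm⟩
  · rintro ⟨m, rfl⟩
    exact ⟨_, orbit_eq_tensors (normalForm_mem m)⟩

lemma card_orbitName : Nat.card OrbitName = 14 := by
  have e : OrbitName ≃ Fin 14 :=
    { toFun m := ⟨m.ctorIdx, by cases m <;> decide⟩
      invFun := ![.M1, .M2, .M3, .M4, .M5, .M6, .M7, .M8, .M9, .M10, .M11, .M12, .M13, .M14]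
      left_inv m := by cases m <;> rfl
      right_inv i := by fin_cases i <;> rfl }
  rw [Nat.card_congr e, Nat.card_eq_fintype_card, Fintype.card_fin]

lemma card_orbits : Nat.card (MulAction.orbitRel.Quotient webGroup KillingTensor) = 14 := by
  rw [← card_orbitName]
  refine (Nat.card_congr (Equiv.ofBijective
    (fun m => Quotient.mk (MulAction.orbitRel webGroup KillingTensor) (normalForm m).tensor)
    ⟨fun m m' h => ?_, fun x => ?_⟩)).symm
  · have h1 := MulAction.orbitRel_apply.1 (Quotient.exact h)
    rw [orbit_eq_tensors (normalForm_mem m')] at h1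
    exact eq_of_mem_tensors (normalForm_mem m) h1
  · induction x using Quotient.inductionOn with | _ K
    obtain ⟨m, hm⟩ := exists_mem_tensors K
    refine ⟨m, Quotient.sound (MulAction.orbitRel_apply.2 ?_)⟩
    rw [orbit_eq_tensors hm]
    exact normalForm_mem m

/-! ### Regular points and webs -/

lemma hasEigenvector_mixed_iff (K : TensorField) (q w : Plane) (μ : ℝ) :
    (mixed K q).HasEigenvector μ w ↔ w ≠ 0 ∧ K q 0 0 * w 0 - K q 0 1 * w 1 = μ * w 0 ∧
      K q 1 0 * w 0 - K q 1 1 * w 1 = μ * w 1 := by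
  rw [Module.End.hasEigenvector_iff, Module.End.mem_eigenspace_iff, and_comm, funext_iff,
    Fin.forall_fin_two]
  simp only [mixed, metric, Matrix.toLin'_apply, Matrix.mulVec, dotProduct, Matrix.mul_apply,
    Fin.sum_univ_two, Pi.smul_apply, smul_eq_mul]
  simp [sub_eq_add_neg]

section

variable (γ a b c d e : ℝ) (q : Plane)

/-- The component `K^{uu}` in null coordinates. -/
def compU (γ a c : ℝ) (q : Plane) : ℝ := γ * (q 0 + q 1) ^ 2 + 2 * a * (q 0 + q 1) + c

/-- The component `K^{vv}` in null coordinates. -/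
def compV (γ b d : ℝ) (q : Plane) : ℝ := γ * (q 0 - q 1) ^ 2 + 2 * b * (q 0 - q 1) + d

/-- The component `K^{uv}` in null coordinates. -/
def compUV (γ a b e : ℝ) (q : Plane) : ℝ :=
  e - γ * (q 0 + q 1) * (q 0 - q 1) - b * (q 0 + q 1) - a * (q 0 - q 1)

lemma field_ofNull : (ofNull γ a b c d e).field q =
    !![(compU γ a c q + compV γ b d q + 2 * compUV γ a b e q) / 4,
      (compU γ a c q - compV γ b d q) / 4;
      (compU γ a c q - compV γ b d q) / 4,
      (compU γ a c q + compV γ b d q - 2 * compUV γ a b e q) / 4] := by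
  ext i j
  fin_cases i <;> fin_cases j <;> simp [Param.field, ofNull, compU, compV, compUV] <;> ring

lemma hasEigenvector_ofNull (w : Plane) (μ : ℝ) :
    (mixed (ofNull γ a b c d e).field q).HasEigenvector μ w ↔ w ≠ 0 ∧
      compU γ a c q * (w 0 - w 1) = (2 * μ - compUV γ a b e q) * (w 0 + w 1) ∧
      compV γ b d q * (w 0 + w 1) = (2 * μ - compUV γ a b e q) * (w 0 - w 1) := by
  rw [hasEigenvector_mixed_iff, field_ofNull]
  simp
  intro _
  constructor <;> rintro ⟨h1, h2⟩ <;> constructor <;> linarith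

end

lemma plane_ne_zero_iff (w : Plane) : w ≠ 0 ↔ w 0 + w 1 ≠ 0 ∨ w 0 - w 1 ≠ 0 := by
  rw [← not_and_or, not_iff_not]
  constructor
  · rintro rfl; simp
  · rintro ⟨h1, h2⟩
    ext i; fin_cases i <;> simp <;> linarith

/-- The characteristic equation in null components, where the off-diagonal entries are `K^{uu}` and
`K^{vv}`. -/
lemma hasEigenvalue_ofNull (γ a b c d e : ℝ) (q : Plane) (μ : ℝ) :
    (mixed (ofNull γ a b c d e).field q).HasEigenvalue μ ↔
      (2 * μ - compUV γ a b e q) ^ 2 = compU γ a c q * compV γ b d q := by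
  constructor
  · intro h
    obtain ⟨w, hw⟩ := h.exists_hasEigenvector
    rw [hasEigenvector_ofNull, plane_ne_zero_iff] at hw
    obtain ⟨hw, h1, h2⟩ := hw
    rcases hw with hw | hw <;> refine mul_right_cancel₀ hw ?_
    · linear_combination (-(2 * μ - compUV γ a b e q)) * h1 - compU γ a c q * h2
    · linear_combination (-(2 * μ - compUV γ a b e q)) * h2 - compV γ b d q * h1
  · intro h
    set z := 2 * μ - compUV γ a b e q with hz
    by_cases hP : compU γ a c q = 0
    · have hz0 : z = 0 := by simpa [hP] using h
      by_cases hQ : compV γ b d q = 0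
      · refine Module.End.hasEigenvalue_of_hasEigenvector (x := ![1, 1])
          ((hasEigenvector_ofNull ..).2 ?_)
        rw [← hz, hz0, hP, hQ, plane_ne_zero_iff]
        simp
      · refine Module.End.hasEigenvalue_of_hasEigenvector (x := ![1, -1])
          ((hasEigenvector_ofNull ..).2 ?_)
        rw [← hz, hz0, hP, plane_ne_zero_iff]
        norm_num
    -- The eigenvector has null components `w_u = K^{uu}`, `w_v = z`.
    · refine Module.End.hasEigenvalue_of_hasEigenvector
        (x := ![(compU γ a c q + z) / 2, (compU γ a c q - z) / 2])
          ((hasEigenvector_ofNull ..).2 ?_)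
      rw [← hz, plane_ne_zero_iff]
      simp only [Matrix.cons_val_zero, Matrix.cons_val_one]
      refine ⟨.inl ?_, by ring, by linear_combination -h⟩
      ring_nf; exact hP

lemma isRegularAt_ofNull (γ a b c d e : ℝ) (q : Plane) :
    IsRegularAt (ofNull γ a b c d e).field q ↔ 0 < compU γ a c q * compV γ b d q := by
  simp only [IsRegularAt, hasEigenvalue_ofNull]
  constructor
  · rintro ⟨x, y, hxy, hx, hy⟩
    refine lt_of_le_of_ne (hx ▸ sq_nonneg _) fun h => hxy ?_
    rw [← h, sq_eq_zero_iff] at hx hy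
    linarith
  · intro h
    have hs := Real.sq_sqrt h.le
    have hs' := Real.sqrt_pos.2 h
    refine ⟨(compUV γ a b e q + √(compU γ a c q * compV γ b d q)) / 2,
      (compUV γ a b e q - √(compU γ a c q * compV γ b d q)) / 2, fun h => by linarith, ?_, ?_⟩ <;>
    · refine Eq.trans ?_ hs; ring

/-- Eliminating `μ` from the two eigenvector equations leaves a relation free of `K^{uv}`.
Conversely, at a regular point `w_u ≠ 0`, so `μ` is recovered by division. -/
lemma mem_web_ofNull (γ a b c d e : ℝ) (q w : Plane) :
    (q, w) ∈ web (ofNull γ a b c d e).field ↔ 0 < compU γ a c q * compV γ b d q ∧ w ≠ 0 ∧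
      compU γ a c q * (w 0 - w 1) ^ 2 = compV γ b d q * (w 0 + w 1) ^ 2 := by
  simp only [web, Set.mem_ofPred_eq, isRegularAt_ofNull, hasEigenvector_ofNull]
  refine and_congr_right fun hr => ?_
  constructor
  · rintro ⟨μ, hw, h1, h2⟩
    exact ⟨hw, by linear_combination (w 0 - w 1) * h1 - (w 0 + w 1) * h2⟩
  · rintro ⟨hw, h⟩
    have hu : w 0 + w 1 ≠ 0 := by
      intro h0
      rw [h0] at h
      have : w 0 - w 1 = 0 := by simpa [left_ne_zero_of_mul hr.ne'] using h
      simp [plane_ne_zero_iff, h0, this] at hw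
    refine ⟨(compU γ a c q * (w 0 - w 1) / (w 0 + w 1) + compUV γ a b e q) / 2, hw, ?_, ?_⟩
    · field_simp; ring
    · field_simp; linear_combination -h

/-! ### Characteristic tensors -/

lemma isCharacteristic_ofNull (γ a b c d e : ℝ) :
    IsCharacteristic (ofNull γ a b c d e).field ↔ ∃ q, 0 < compU γ a c q * compV γ b d q := by
  simp only [IsCharacteristic, isRegularAt_ofNull]
  constructor
  · rintro ⟨U, -, ⟨q, hq⟩, h⟩
    exact ⟨q, h q hq⟩
  · rintro ⟨q, hq⟩
    refine ⟨{q | 0 < compU γ a c q * compV γ b d q}, ?_, ⟨q, hq⟩, fun q h => h⟩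
    refine isOpen_lt continuous_const ?_
    unfold compU compV
    fun_prop

lemma exists_gamma_mul_pos {γ : ℝ} (hγ : γ ≠ 0) (a c : ℝ) :
    ∃ u : ℝ, 0 < γ * (γ * u ^ 2 + 2 * a * u + c) := by
  -- Since `γ P(u) = (γ u + a)² + (γ c - a²)`, the point is chosen so that `γ u + a = 1 + |γ c -
  -- a²|`.
  refine ⟨(1 + |γ * c - a ^ 2| - a) / γ, ?_⟩
  have h : γ * (γ * ((1 + |γ * c - a ^ 2| - a) / γ) ^ 2
      + 2 * a * ((1 + |γ * c - a ^ 2| - a) / γ) + c)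
      = (1 + |γ * c - a ^ 2|) ^ 2 + (γ * c - a ^ 2) := by
    field_simp; ring
  rw [h]
  have h1 := neg_abs_le (γ * c - a ^ 2)
  nlinarith [abs_nonneg (γ * c - a ^ 2), sq_nonneg |γ * c - a ^ 2|]

lemma exists_comp_eq (γ a b c d u v : ℝ) : ∃ q : Plane,
    compU γ a c q = γ * u ^ 2 + 2 * a * u + c ∧ compV γ b d q = γ * v ^ 2 + 2 * b * v + d := by
  refine ⟨![(u + v) / 2, (u - v) / 2], ?_, ?_⟩ <;> simp [compU, compV] <;> ring

/-- The question is whether `P(u) Q(v)` is positive somewhere. For `γ ≠ 0` both factors take the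
sign of `γ` far out, and a non-constant linear factor takes any value. Positivity fails only when a
factor vanishes identically (M10, M13, M14) or both are constants of opposite sign (M12). -/
lemma isCharacteristic_iff_of_nullClass {γ a b c d e : ℝ} {m : OrbitName}
    (h : nullClass γ a b c d m) : IsCharacteristic (ofNull γ a b c d e).field ↔
      m ≠ .M10 ∧ m ≠ .M12 ∧ m ≠ .M13 ∧ m ≠ .M14 := by
  rw [isCharacteristic_ofNull]
  have hγ : γ ≠ 0 → ∃ q, 0 < compU γ a c q * compV γ b d q := by
    intro hγ
    obtain ⟨u, hu⟩ := exists_gamma_mul_pos hγ a c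
    obtain ⟨v, hv⟩ := exists_gamma_mul_pos hγ b d
    obtain ⟨q, h1, h2⟩ := exists_comp_eq γ a b c d u v
    refine ⟨q, ?_⟩
    rw [h1, h2]
    refine pos_of_mul_pos_right (a := γ ^ 2) ?_ (sq_nonneg γ)
    nlinarith [mul_pos hu hv]
  have hab : γ = 0 → a * b ≠ 0 → ∃ q, 0 < compU γ a c q * compV γ b d q := by
    rintro rfl hab
    have ha := left_ne_zero_of_mul hab
    have hb := right_ne_zero_of_mul hab
    obtain ⟨q, h1, h2⟩ := exists_comp_eq 0 a b c d ((1 - c) / (2 * a)) ((1 - d) / (2 * b))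
    refine ⟨q, ?_⟩
    rw [h1, h2]
    have e1 : 0 * ((1 - c) / (2 * a)) ^ 2 + 2 * a * ((1 - c) / (2 * a)) + c = 1 := by
      field_simp; ring
    have e2 : 0 * ((1 - d) / (2 * b)) ^ 2 + 2 * b * ((1 - d) / (2 * b)) + d = 1 := by
      field_simp; ring
    rw [e1, e2]; norm_num
  cases m <;> simp only [nullClass] at h <;> simp only [ne_eq, reduceCtorEq, not_false_eq_true,
    and_self, iff_true, not_true_eq_false, and_false, false_and, iff_false, not_exists, not_lt]
  case M7 => exact hab h.1 h.2.ne
  case M8 => exact hab h.1 h.2.ne'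
  case M9 =>
    obtain ⟨rfl, ⟨ha, rfl, hd⟩ | ⟨rfl, hb, hc⟩⟩ := h
    · obtain ⟨q, h1, h2⟩ := exists_comp_eq 0 a 0 c d ((d - c) / (2 * a)) 0
      refine ⟨q, ?_⟩
      have e1 : 0 * ((d - c) / (2 * a)) ^ 2 + 2 * a * ((d - c) / (2 * a)) + c = d := by
        field_simp; ring
      rw [h1, h2, e1]
      simpa using mul_self_pos.2 hd
    · obtain ⟨q, h1, h2⟩ := exists_comp_eq 0 0 b c d 0 ((c - d) / (2 * b))
      refine ⟨q, ?_⟩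
      have e1 : 0 * ((c - d) / (2 * b)) ^ 2 + 2 * b * ((c - d) / (2 * b)) + d = c := by
        field_simp; ring
      rw [h1, h2, e1]
      simpa using mul_self_pos.2 hc
  case M10 =>
    intro q
    obtain ⟨rfl, ⟨-, rfl, rfl⟩ | ⟨rfl, -, rfl⟩⟩ := h <;> simp [compU, compV]
  case M11 =>
    obtain ⟨rfl, rfl, rfl, h⟩ := h
    exact ⟨0, by simpa [compU, compV] using h⟩
  case M12 =>
    obtain ⟨rfl, rfl, rfl, h⟩ := h
    intro q
    simpa [compU, compV] using h.le
  case M13 =>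
    obtain ⟨rfl, rfl, rfl, ⟨rfl, -⟩ | ⟨-, rfl⟩⟩ := h <;> simp [compU, compV]
  case M14 =>
    obtain ⟨rfl, rfl, rfl, rfl, rfl⟩ := h
    simp [compU, compV]
  all_goals exact hγ h.1

/-! ### Transformation of webs -/

lemma compU_direct {Θ : Plane → Plane} {k l u v : ℝ} (h : IsDirect Θ k l u v) (γ a c : ℝ)
    (q : Plane) : compU γ (a * k - γ * u) (c * k ^ 2 - 2 * a * k * u + γ * u ^ 2) (Θ q)
      = k ^ 2 * compU γ a c q := by
  simp only [compU, h.sum]; ring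

lemma compV_direct {Θ : Plane → Plane} {k l u v : ℝ} (h : IsDirect Θ k l u v) (γ b d : ℝ)
    (q : Plane) : compV γ (b * l - γ * v) (d * l ^ 2 - 2 * b * l * v + γ * v ^ 2) (Θ q)
      = l ^ 2 * compV γ b d q := by
  simp only [compV, h.diff]; ring

lemma compU_swap {Θ : Plane → Plane} {k l u v : ℝ} (h : IsSwap Θ k l u v) (γ b d : ℝ)
    (q : Plane) : compU γ (b * k - γ * u) (d * k ^ 2 - 2 * b * k * u + γ * u ^ 2) (Θ q)
      = k ^ 2 * compV γ b d q := by
  simp only [compU, compV, h.sum]; ring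

lemma compV_swap {Θ : Plane → Plane} {k l u v : ℝ} (h : IsSwap Θ k l u v) (γ a c : ℝ)
    (q : Plane) : compV γ (a * l - γ * v) (c * l ^ 2 - 2 * a * l * v + γ * v ^ 2) (Θ q)
      = l ^ 2 * compU γ a c q := by
  simp only [compU, compV, h.diff]; ring

/-- In the direct case `P`, `Q`, `w_u`, `w_v` are multiplied by `k²`, `l²`, `k`, `l`, so both sides
of the web equation gain the factor `k² l²`. A swap also exchanges the two sides. -/
lemma mem_web_pushforward {Θ : Plane ≃ Plane} (h : IsSimilarity Θ) {K : TensorField}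
    (hK : IsKilling K) (q w : Plane) :
    (Θ q, fderiv ℝ Θ q w) ∈ web (pushforward Θ K) ↔ (q, w) ∈ web K := by
  obtain ⟨γ, a, b, c, d, e, rfl⟩ := hK.exists_ofNull
  obtain ⟨k, l, u, v, hkl, h | h⟩ := h
  all_goals
    have hk : k ≠ 0 := left_ne_zero_of_mul hkl.ne'
    have hl : l ≠ 0 := right_ne_zero_of_mul hkl.ne'
    have hp : 0 < k ^ 2 * l ^ 2 := by positivity
  · rw [pushforward_direct h, mem_web_ofNull, mem_web_ofNull, compU_direct h, compV_direct h,
      plane_ne_zero_iff, plane_ne_zero_iff, (h.fderiv_apply q w).1, (h.fderiv_apply q w).2]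
    refine and_congr ?_ (and_congr (by simp [hk, hl]) ?_)
    · rw [← mul_pos_iff_of_pos_left hp (b := compU γ a c q * compV γ b d q)]
      ring_nf
    · rw [← mul_right_inj' hp.ne' (b := compU γ a c q * (w 0 - w 1) ^ 2)]
      ring_nf
  · rw [pushforward_swap h, mem_web_ofNull, mem_web_ofNull, compU_swap h, compV_swap h,
      plane_ne_zero_iff, plane_ne_zero_iff, (h.fderiv_apply q w).1, (h.fderiv_apply q w).2]
    refine and_congr ?_ (and_congr (by simp [hk, hl, or_comm]) ?_)
    · rw [← mul_pos_iff_of_pos_left hp (b := compU γ a c q * compV γ b d q)]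
      ring_nf
    · rw [← mul_right_inj' hp.ne' (b := compU γ a c q * (w 0 - w 1) ^ 2), eq_comm]
      ring_nf

lemma fderiv_fderiv_symm {Θ : Plane ≃ Plane} (h : IsSimilarity Θ) (q w : Plane) :
    fderiv ℝ Θ q (fderiv ℝ Θ.symm (Θ q) w) = w := by
  have h1 := jacobian_symm_mul h.symm (Θ q)
  rw [Equiv.symm_symm, Equiv.symm_apply_apply] at h1
  rw [← jacobian_mulVec, ← jacobian_mulVec, Matrix.mulVec_mulVec, h1, Matrix.one_mulVec]

lemma mapDirections_web {Θ : Plane ≃ Plane} (h : IsSimilarity Θ) {K : TensorField}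
    (hK : IsKilling K) : mapDirections Θ (web K) = web (pushforward Θ K) := by
  ext ⟨q, w⟩
  obtain ⟨q, rfl⟩ := Θ.surjective q
  rw [← fderiv_fderiv_symm h q w, mem_web_pushforward h hK]
  constructor
  · rintro ⟨⟨q', w'⟩, hw, e⟩
    rw [Prod.mk.injEq] at e
    obtain ⟨e1, e2⟩ := e
    obtain rfl := Θ.injective e1
    simp only [fderiv_fderiv_symm h] at e2
    rw [← e2]
    rw [← mem_web_pushforward h hK, fderiv_fderiv_symm h, mem_web_pushforward h hK]
    exact hw
  · exact fun hw => ⟨_, hw, rfl⟩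

lemma mapDirections_trans {Θ Θ' : Plane ≃ Plane} (h : IsSimilarity Θ) (h' : IsSimilarity Θ')
    (W : Set (Plane × Plane)) :
    mapDirections Θ' (mapDirections Θ W) = mapDirections (Θ.trans Θ') W := by
  rw [mapDirections, mapDirections, mapDirections, Set.image_image]
  refine Set.image_congr fun w _ => ?_
  have := (h'.differentiable (Θ w.1)).hasFDerivAt.comp w.1 (h.differentiable w.1).hasFDerivAt
  exact Prod.ext rfl (DFunLike.congr_fun this.fderiv w.2).symm

lemma sameWebType_iff {K L : TensorField} : SameWebType K L ↔
    ∃ Θ : Plane ≃ Plane, IsSimilarity Θ ∧ mapDirections Θ (web K) = web L := by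
  constructor
  · rintro ⟨Φ, Ψ, hΦ, hΨ, h⟩
    rw [mapDirections_trans hΦ.isSimilarity hΨ.isSimilarity] at h
    exact ⟨_, hΦ.isSimilarity.trans hΨ.isSimilarity, h⟩
  · rintro ⟨Θ, hΘ, h⟩
    obtain ⟨Φ, Ψ, hΦ, hΨ, rfl⟩ := hΘ.exists_eq_trans
    exact ⟨Φ, Ψ, hΦ, hΨ, by rw [mapDirections_trans hΦ.isSimilarity hΨ.isSimilarity, h]⟩

lemma isSimilarity_refl : IsSimilarity (Equiv.refl Plane) :=
  ⟨1, 1, 0, 0, by norm_num, .inl ⟨fun q => by simp, fun q => by simp⟩⟩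

lemma mapDirections_refl (W : Set (Plane × Plane)) : mapDirections (Equiv.refl Plane) W = W := by
  simp [mapDirections, Equiv.coe_refl, fderiv_id]

lemma SameWebType.of_web_eq {K L : TensorField} (h : web K = web L) : SameWebType K L :=
  sameWebType_iff.2 ⟨_, isSimilarity_refl, by rw [mapDirections_refl, h]⟩

lemma SameWebType.trans {K L N : TensorField} (h : SameWebType K L) (h' : SameWebType L N) :
    SameWebType K N := by
  rw [sameWebType_iff] at *
  obtain ⟨Θ, hΘ, e⟩ := h
  obtain ⟨Θ', hΘ', e'⟩ := h'
  exact ⟨_, hΘ.trans hΘ', by rw [← mapDirections_trans hΘ hΘ', e, e']⟩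

lemma SameWebType.symm {K L : TensorField} (h : SameWebType K L) : SameWebType L K := by
  rw [sameWebType_iff] at *
  obtain ⟨Θ, hΘ, e⟩ := h
  refine ⟨_, hΘ.symm, ?_⟩
  rw [← e, mapDirections_trans hΘ hΘ.symm, Equiv.self_trans_symm, mapDirections_refl]

lemma sameWebType_pushforward {Θ : Plane ≃ Plane} (h : IsSimilarity Θ) {K : TensorField}
    (hK : IsKilling K) : SameWebType K (pushforward Θ K) :=
  sameWebType_iff.2 ⟨Θ, h, mapDirections_web h hK⟩

lemma web_add_metric {K : TensorField} (hK : IsKilling K) (τ : ℝ) :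
    web (fun q => K q + τ • metric) = web K := by
  obtain ⟨γ, a, b, c, d, e, rfl⟩ := hK.exists_ofNull
  rw [field_add_metric]
  ext ⟨q, w⟩
  rw [mem_web_ofNull, mem_web_ofNull]

lemma web_smul {K : TensorField} (hK : IsKilling K) {r : ℝ} (hr : r ≠ 0) :
    web (fun q => r • K q) = web K := by
  obtain ⟨γ, a, b, c, d, e, rfl⟩ := hK.exists_ofNull
  rw [smul_field]
  ext ⟨q, w⟩
  have hU : compU (r * γ) (r * a) (r * c) q = r * compU γ a c q := by
    simp only [compU]; ring
  have hV : compV (r * γ) (r * b) (r * d) q = r * compV γ b d q := by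
    simp only [compV]; ring
  have hr2 : 0 < r ^ 2 := by positivity
  rw [mem_web_ofNull, mem_web_ofNull, hU, hV, mul_mul_mul_comm, ← sq,
    mul_pos_iff_of_pos_left hr2, mul_assoc, mul_assoc, mul_right_inj' hr]

lemma sameWebType_of_mem_webGroup {σ : Equiv.Perm KillingTensor} (hσ : σ ∈ webGroup)
    (K : KillingTensor) : SameWebType (K : TensorField) (σ K : TensorField) := by
  induction hσ using Subgroup.closure_induction generalizing K with
  | mem σ hσ =>
    cases hσ with
    | isometry Φ hΦ h => rw [h]; exact sameWebType_pushforward hΦ.isSimilarity K.2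
    | dilatation Φ hΦ h => rw [h]; exact sameWebType_pushforward hΦ.isSimilarity K.2
    | addMetric τ h => rw [h]; exact .of_web_eq (web_add_metric K.2 τ).symm
    | scale r hr h => rw [h]; exact .of_web_eq (web_smul K.2 hr).symm
  | one => exact .of_web_eq rfl
  | mul σ τ _ _ h1 h2 => exact (h2 K).trans (h1 (τ K))
  | inv σ _ h1 =>
    have := h1 (σ⁻¹ K)
    rw [show σ (σ⁻¹ K) = K from σ.apply_symm_apply K] at this
    exact this.symm

/-! ### A web determines its tensor up to scale and the metric -/

/-- Three equally spaced points suffice: the second difference isolates the leading coefficient. -/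
lemma coeff_eq_zero_of_eventually {r s t x : ℝ}
    (h : ∀ᶠ y in nhds x, r * y ^ 2 + 2 * s * y + t = 0) : r = 0 ∧ s = 0 ∧ t = 0 := by
  obtain ⟨ε, hε, h⟩ := Metric.eventually_nhds_iff.1 h
  have h0 := h (y := x) (by simpa using hε)
  have h1 := h (y := x + ε / 2) (by simp [abs_of_pos hε]; linarith)
  have h2 := h (y := x - ε / 2) (by simp [abs_of_pos hε]; linarith)
  have hr : r * ε ^ 2 = 0 := by linear_combination 2 * h1 + 2 * h2 - 4 * h0
  have hr : r = 0 := (mul_eq_zero.1 hr).resolve_right (by positivity)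
  subst hr
  have hs : s * ε = 0 := by linear_combination h1 - h0
  have hs : s = 0 := (mul_eq_zero.1 hs).resolve_right hε.ne'
  subst hs
  exact ⟨rfl, rfl, by linarith⟩

/-- Equal webs give `Q P' = Q' P` wherever `P Q > 0`. Fixing `v` and varying `u` makes `P'` a
multiple of `P`; fixing `u` makes `Q'` a multiple of `Q`. The two factors agree at the base point,
so the tensors differ by a scaling and a multiple of the metric. -/
lemma orbit_eq_of_web_eq {K L : KillingTensor} (hK : IsCharacteristic (K : TensorField))
    (h : web (K : TensorField) = web (L : TensorField)) :
    MulAction.orbit webGroup K = MulAction.orbit webGroup L := by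
  obtain ⟨γ, a, b, c, d, e, rfl⟩ := exists_ofNull_tensor K
  obtain ⟨γ', a', b', c', d', e', rfl⟩ := exists_ofNull_tensor L
  obtain ⟨q, hq⟩ := (isCharacteristic_ofNull ..).1 hK
  have key : ∀ q, 0 < compU γ a c q * compV γ b d q →
      0 < compU γ' a' c' q * compV γ' b' d' q ∧
      compV γ b d q * compU γ' a' c' q = compV γ' b' d' q * compU γ a c q := by
    intro q hq
    set P := compU γ a c q with hP
    set Q := compV γ b d q with hQ
    have hPQ : P * |Q| = Q * |P| := by
      rcases mul_pos_iff.1 hq with ⟨h1, h2⟩ | ⟨h1, h2⟩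
      · rw [abs_of_pos h1, abs_of_pos h2, mul_comm]
      · rw [abs_of_neg h1, abs_of_neg h2]; ring
    have hP' := Real.sq_sqrt (abs_nonneg P)
    have hQ' := Real.sq_sqrt (abs_nonneg Q)
    have hs : √|P| ≠ 0 := (Real.sqrt_pos.2 (abs_pos.2 (left_ne_zero_of_mul hq.ne'))).ne'
    -- An eigenvector of the first tensor, with null components `√|P|` and `√|Q|`; its membership in
    -- the second web is what compares the two ratios.
    set w : Plane := ![(√|P| + √|Q|) / 2, (√|P| - √|Q|) / 2] with hw
    have w1 : w 0 + w 1 = √|P| := by simp [hw]; ring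
    have w2 : w 0 - w 1 = √|Q| := by simp [hw]; ring
    have hmem : (q, w) ∈ web (ofNull γ a b c d e).field := by
      rw [mem_web_ofNull, ← hP, ← hQ, plane_ne_zero_iff, w1, w2, hP', hQ']
      exact ⟨hq, .inl hs, hPQ⟩
    have hmem' : (q, w) ∈ web (ofNull γ' a' b' c' d' e').field := h ▸ hmem
    rw [mem_web_ofNull, w1, w2, hP', hQ'] at hmem'
    refine ⟨hmem'.1, ?_⟩
    have h3 := hmem'.2.2
    rcases mul_pos_iff.1 hq with ⟨h1, h2⟩ | ⟨h1, h2⟩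
    · rw [abs_of_pos h1, abs_of_pos h2] at h3
      linarith
    · rw [abs_of_neg h1, abs_of_neg h2] at h3
      linarith
  obtain ⟨u, hu⟩ : ∃ u, u = q 0 + q 1 := ⟨_, rfl⟩
  obtain ⟨v, hv⟩ : ∃ v, v = q 0 - q 1 := ⟨_, rfl⟩
  have hcomp : ∀ (x y : ℝ), ∃ q : Plane, q 0 + q 1 = x ∧ q 0 - q 1 = y := fun x y =>
    ⟨![(x + y) / 2, (x - y) / 2], by simp; ring, by simp; ring⟩
  have hU : ∀ᶠ x in nhds u, (compV γ b d q * γ' - compV γ' b' d' q * γ) * x ^ 2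
      + 2 * (compV γ b d q * a' - compV γ' b' d' q * a) * x
      + (compV γ b d q * c' - compV γ' b' d' q * c) = 0 := by
    have hc : Continuous fun x => (γ * x ^ 2 + 2 * a * x + c) * compV γ b d q := by fun_prop
    have : ∀ᶠ x in nhds u, 0 < (γ * x ^ 2 + 2 * a * x + c) * compV γ b d q :=
      hc.continuousAt.eventually_const_lt (by rw [hu]; exact hq)
    filter_upwards [this] with x hx
    obtain ⟨q', h1, h2⟩ := hcomp x v
    have := (key q' (by simpa only [compU, compV, h1, h2, hv] using hx)).2
    simp only [compU, compV, h1, h2, ← hv] at this ⊢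
    linear_combination this
  have hV : ∀ᶠ y in nhds v, (compU γ a c q * γ' - compU γ' a' c' q * γ) * y ^ 2
      + 2 * (compU γ a c q * b' - compU γ' a' c' q * b) * y
      + (compU γ a c q * d' - compU γ' a' c' q * d) = 0 := by
    have hc : Continuous fun y => compU γ a c q * (γ * y ^ 2 + 2 * b * y + d) := by fun_prop
    have : ∀ᶠ y in nhds v, 0 < compU γ a c q * (γ * y ^ 2 + 2 * b * y + d) :=
      hc.continuousAt.eventually_const_lt (by rw [hv]; exact hq)
    filter_upwards [this] with y hy
    obtain ⟨q', h1, h2⟩ := hcomp u y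
    have := (key q' (by simpa only [compU, compV, h1, h2, hu] using hy)).2
    simp only [compU, compV, h1, h2, ← hu] at this ⊢
    linear_combination -this
  obtain ⟨e1, e2, e3⟩ := coeff_eq_zero_of_eventually hU
  obtain ⟨-, e4, e5⟩ := coeff_eq_zero_of_eventually hV
  obtain ⟨hpos, e6⟩ := key q hq
  have hP := left_ne_zero_of_mul hq.ne'
  have hQ := right_ne_zero_of_mul hq.ne'
  have hQ' := right_ne_zero_of_mul hpos.ne'
  -- The proportionality factors found from `u` and from `v` coincide.
  have e7 : compU γ' a' c' q / compU γ a c q = compV γ' b' d' q / compV γ b d q := by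
    field_simp; linear_combination e6
  have s1 : γ' = compV γ' b' d' q / compV γ b d q * γ := by
    field_simp; linear_combination e1
  have s2 : a' = compV γ' b' d' q / compV γ b d q * a := by
    field_simp; linear_combination e2
  have s3 : c' = compV γ' b' d' q / compV γ b d q * c := by
    field_simp; linear_combination e3
  have s4 : b' = compV γ' b' d' q / compV γ b d q * b := by
    rw [← e7]; field_simp; linear_combination e4
  have s5 : d' = compV γ' b' d' q / compV γ b d q * d := by
    rw [← e7]; field_simp; linear_combination e5
  have hr : compV γ' b' d' q / compV γ b d q ≠ 0 := div_ne_zero hQ' hQ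
  generalize compV γ' b' d' q / compV γ b d q = r at *
  subst s1 s2 s3 s4 s5
  exact orbit_scale hr ..

lemma sameWebType_iff_orbit_eq {K L : KillingTensor}
    (hK : IsCharacteristic (K : TensorField)) :
    SameWebType (K : TensorField) (L : TensorField) ↔
      MulAction.orbit webGroup K = MulAction.orbit webGroup L := by
  constructor
  · intro h
    obtain ⟨Θ, hΘ, h⟩ := sameWebType_iff.1 h
    rw [mapDirections_web hΘ K.2] at h
    obtain ⟨m, hm⟩ := exists_mem_tensors K
    have hm' : pushforwardPerm Θ hΘ K ∈ m.tensors := pushforward_mem_tensors hΘ rfl hm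
    -- The push-forward stays in the class of `K`, and the class decides whether a tensor is
    -- characteristic.
    have hK' : IsCharacteristic (pushforwardPerm Θ hΘ K : TensorField) := by
      obtain ⟨γ, a, b, c, d, e, h1⟩ := exists_ofNull_tensor K
      obtain ⟨γ', a', b', c', d', e', h2⟩ := exists_ofNull_tensor (pushforwardPerm Θ hΘ K)
      rw [h1] at hK hm
      rw [h2] at hm' ⊢
      rw [ofNull_tensor_mem_tensors] at hm hm'
      exact (isCharacteristic_iff_of_nullClass hm').2 ((isCharacteristic_iff_of_nullClass hm).1 hK)
    exact (orbit_pushforward hΘ K).trans (orbit_eq_of_web_eq hK' h)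
  · intro h
    obtain ⟨σ, rfl⟩ := MulAction.orbit_eq_iff.1 h.symm
    exact sameWebType_of_mem_webGroup σ.2 K

/-! ### Representatives, multiples of the metric, and characteristic classes -/

lemma exists_representative (m : OrbitName) (p : Param) (hp : p ∈ m.representatives) :
    ∃ K ∈ m.tensors, (K : TensorField) = p.field := by
  refine ⟨p.tensor, ⟨p, ?_, rfl⟩, rfl⟩
  obtain ⟨γ, a, b, c, d, e, h⟩ : ∃ γ a b c d e : ℝ, p = ofNull γ a b c d e ∧ a = p.α + p.β ∧
      b = p.β - p.α ∧ c = p.A + p.B + 2 * p.C ∧ d = p.A + p.B - 2 * p.C ∧ γ = p.γ :=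
    ⟨p.γ, p.α + p.β, p.β - p.α, p.A + p.B + 2 * p.C, p.A + p.B - 2 * p.C, p.A - p.B, by
      ext <;> simp only [ofNull] <;> ring, rfl, rfl, rfl, rfl, rfl⟩
  obtain ⟨h0, h1, h2, h3, h4, h5⟩ := h
  rw [h0, ofNull_mem_params]
  clear h0
  cases m <;> simp only [OrbitName.representatives, Set.mem_insert_iff,
    Set.mem_singleton_iff] at hp
  case M4 | M5 | M9 => rcases hp with rfl | rfl <;> norm_num [nullClass, h1, h2, h3, h4, h5]
  all_goals subst hp; norm_num [nullClass, h1, h2, h3, h4, h5]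

lemma mem_M14_tensors_iff (K : KillingTensor) : K ∈ OrbitName.M14.tensors ↔
    ∃ τ : ℝ, (K : TensorField) = fun _ => τ • metric := by
  constructor
  · rintro ⟨p, ⟨h1, h2, h3, h4, h5⟩, h⟩
    refine ⟨p.A, h.trans ?_⟩
    funext q
    ext i j
    fin_cases i <;> fin_cases j <;> simp [Param.field, metric, h1, h2, h3, h4, h5]
  · rintro ⟨τ, h⟩
    refine ⟨⟨τ, -τ, 0, 0, 0, 0⟩, ⟨rfl, rfl, rfl, rfl, rfl⟩, h.trans ?_⟩
    funext q
    ext i j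
    fin_cases i <;> fin_cases j <;> simp [Param.field, metric]

lemma isCharacteristic_iff_of_mem_tensors {m : OrbitName} {K : KillingTensor}
    (h : K ∈ m.tensors) : IsCharacteristic (K : TensorField) ↔
      m ≠ .M10 ∧ m ≠ .M12 ∧ m ≠ .M13 ∧ m ≠ .M14 := by
  obtain ⟨γ, a, b, c, d, e, rfl⟩ := exists_ofNull_tensor K
  exact isCharacteristic_iff_of_nullClass ((ofNull_tensor_mem_tensors ..).1 h)

end Minkowski

theorem mainTheorem2 :
    -- the general Killing tensor: the six parameters are global coordinates
    (∀ K : Minkowski.TensorField,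
      Minkowski.IsKilling K ↔ ∃! p : Minkowski.Param, K = p.field) ∧
    -- there are exactly fourteen orbits
    Nat.card (MulAction.orbitRel.Quotient Minkowski.webGroup Minkowski.KillingTensor) = 14 ∧
    -- the orbits are the sets `M1`, ..., `M14`, which are pairwise different
    Function.Injective Minkowski.OrbitName.tensors ∧
    Set.range (fun K : Minkowski.KillingTensor => MulAction.orbit Minkowski.webGroup K) =
      Set.range Minkowski.OrbitName.tensors ∧
    -- representatives
    (∀ m : Minkowski.OrbitName, ∀ p ∈ m.representatives, ∃ K ∈ m.tensors,
      (K : Minkowski.TensorField) = p.field) ∧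
    -- `M14` consists of the multiples of the metric
    (∀ K : Minkowski.KillingTensor, K ∈ Minkowski.OrbitName.M14.tensors ↔
      ∃ τ : ℝ, (K : Minkowski.TensorField) = fun _ => τ • Minkowski.metric) ∧
    -- ten orbits consist of characteristic tensors, the other four of non-characteristic ones
    (∀ m : Minkowski.OrbitName, ∀ K ∈ m.tensors,
      Minkowski.IsCharacteristic (K : Minkowski.TensorField) ↔
        m ≠ .M10 ∧ m ≠ .M12 ∧ m ≠ .M13 ∧ m ≠ .M14) ∧
    -- the ten orbits of characteristic tensors correspond to ten types of webs
    (∀ K L : Minkowski.KillingTensor,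
      Minkowski.IsCharacteristic (K : Minkowski.TensorField) →
      Minkowski.IsCharacteristic (L : Minkowski.TensorField) →
      (Minkowski.SameWebType (K : Minkowski.TensorField) (L : Minkowski.TensorField) ↔
        MulAction.orbit Minkowski.webGroup K = MulAction.orbit Minkowski.webGroup L)) := by
  open Minkowski in
  exact ⟨isKilling_iff, card_orbits, tensors_injective, range_orbit, exists_representative,
    mem_M14_tensors_iff, fun _ _ h => isCharacteristic_iff_of_mem_tensors h,
    fun _ _ hK _ => sameWebType_iff_orbit_eq hK⟩
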